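/- For a smooth immersion $F:\mathbb S^2\to\mathbb R^3$ with smooth unit normal field $N$, let $g$ be the induced metric, $\mu$ its area measure, $|M|=\mu(\mathbb S^2)$, and let $H$ be the trace of the shape operator $A^i_j=g^{ik}h_{kj}$ with $h(X,Y)=\langle \nabla_X N,Y\rangle$ (so $H=2$ for the unit sphere with outward normal). A constrained mean curvature flow starting at an embedding $F_0:\mathbb S^2\to\mathbb R^3$ is a family of immersions $F:\mathbb S^2\times[0,T)\to\mathbb R^3$, $T>0$, smooth on $\mathbb S^2\times[0,T)$, with $$\frac{\partial F}{\partial t}(p,t)=\big(h(t)-H(p,t)\big)N(p,t)\quad(0<t<T),\qquad F(\cdot,0)=F_0,$$ where $N$ is the smooth unit normal field along $F$ that at $t=0$ points out of the domain enclosed by $F_0(\mathbb S^2)$. It is the volume preserving flow (VP-MCF) if $h(t)=\frac{1}{|M_t|}\int H\,d\mu_t$, and the area preserving flow (AP-MCF) if $h(t)=\int H^2\,d\mu_t\big/\int H\,d\mu_t$ with $\int H\,d\mu_t\neq0$ for all $t$. **Theorem.** There are a smooth embedding $F_0:\mathbb S^2\to\mathbb R^3$ with image $\Sigma$, numbers $0<a<b$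 and a strictly decreasing concave function $\varphi:[a,b]\to\mathbb R$ with $\varphi(a)=1$, $\varphi(b)=0$, such that the following hold. 1. $\Sigma$ is the (smoothly embedded) sphere of revolution obtained by rotating about the $x_3$-axis the curve $z\mapsto(\rho(z),z)$, $z\in[-b,b]$, where $\rho(z)=\cosh z$ for $|z|\le a$ (a catenoidal neck) and $\rho(z)=\varphi(|z|)\cosh z$ for $a<|z|\le b$ (two caps). 2. Let $U$ be the non-empty open subset $\{|x_3|<a\}$ of $\Sigma$. The mean curvature of $\Sigma$ with respect to the outward unit normal satisfies $H\equiv0$ on the closure $\overline U$ and $H>0$ on $\Sigma\setminus\overline U$. 3. For every solution $F:\mathbb S^2\times[0,T)\to\mathbb R^3$ of VP-MCF or of AP-MCF starting at $F_0$ there is $\varepsilon\in(0,T]$ such that $\inf_{\mathbb S^2}H(\cdot,t)<0$ for all $t\in(0,\varepsilon)$. -/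

import Mathlib

open Set Filter Topology MeasureTheory
open scoped Manifold ContDiff

noncomputable section

namespace ConstrainedMCF

/-- Euclidean three-space `ℝ³`. -/
abbrev E3 := EuclideanSpace ℝ (Fin 3)

/-- The two-sphere `𝕊²`, with its standard smooth structure. -/
abbrev S2 := Metric.sphere (0 : EuclideanSpace ℝ (Fin 3)) 1

/-- The differential `df_p : T_p 𝕊² → ℝ³`. The tangent space `T_p 𝕊²` is modelled on
`EuclideanSpace ℝ (Fin 2)`. -/
def diff (f : S2 → E3) (p : S2) : EuclideanSpace ℝ (Fin 2) →L[ℝ] E3 :=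
  mfderiv (𝓡 2) 𝓘(ℝ, E3) f p

/-- The `i`-th vector of a basis of `T_p 𝕊²`. -/
abbrev tangentBasis (i : Fin 2) : EuclideanSpace ℝ (Fin 2) := EuclideanSpace.single i 1

/-- The matrix `g_{ij} = ⟨df e_i, df e_j⟩` of the metric induced by `f`. -/
def inducedMetric (f : S2 → E3) (p : S2) : Matrix (Fin 2) (Fin 2) ℝ :=
  Matrix.of fun i j => inner ℝ (diff f p (tangentBasis i)) (diff f p (tangentBasis j))

/-- The matrix `h_{ij} = ⟨∇_{e_i} N, e_j⟩ = ⟨dN e_i, df e_j⟩` of the second fundamental form of `f`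
with respect to the unit normal field `N` along `f`. -/
def secondFundamentalForm (f N : S2 → E3) (p : S2) : Matrix (Fin 2) (Fin 2) ℝ :=
  Matrix.of fun i j => inner ℝ (diff N p (tangentBasis i)) (diff f p (tangentBasis j))

/-- The mean curvature `H`, the trace (sum of the eigenvalues) of the shape operator
`A^i_j = g^{ik} h_{kj}`. The unit sphere with outward normal has `H = 2`. -/
def meanCurvature (f N : S2 → E3) (p : S2) : ℝ :=
  ((inducedMetric f p)⁻¹ * secondFundamentalForm f N p).trace

/-- The Riemannian area measure `dμ` on `𝕊²` of the metric induced by `f`: it has density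
`√(det g_f / det g_ι)` with respect to the area measure of the round sphere, where `g_ι` is the
round metric, induced by the inclusion `ι : 𝕊² → ℝ³`. -/
def areaMeasure (f : S2 → E3) : Measure S2 :=
  ((volume : Measure E3).toSphere).withDensity fun p =>
    ENNReal.ofReal (√((inducedMetric f p).det / (inducedMetric (fun q : S2 => (q : E3)) p).det))

/-- The total area `|M| = ∫ dμ`. -/
def area (f : S2 → E3) : ℝ := (areaMeasure f).real univ

/-- The total mean curvature `∫ H dμ`. -/
def totalMeanCurvature (f N : S2 → E3) : ℝ := ∫ p, meanCurvature f N p ∂(areaMeasure f)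

/-- The global term of the volume preserving flow: `(∫ H dμ) / |M|`. -/
def vpTerm (f N : S2 → E3) : ℝ := totalMeanCurvature f N / area f

/-- The global term of the area preserving flow: `(∫ H² dμ) / (∫ H dμ)`. -/
def apTerm (f N : S2 → E3) : ℝ :=
  (∫ p, meanCurvature f N p ^ 2 ∂(areaMeasure f)) / totalMeanCurvature f N

/-- `f` is a smooth immersion of `𝕊²` into `ℝ³`. -/
def IsSmoothImmersion (f : S2 → E3) : Prop :=
  ContMDiff (𝓡 2) 𝓘(ℝ, E3) ∞ f ∧ ∀ p, Function.Injective (diff f p)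

/-- `f` is a smooth embedding of `𝕊²` into `ℝ³`. -/
def IsSmoothEmbedding (f : S2 → E3) : Prop :=
  IsSmoothImmersion f ∧ IsEmbedding f

/-- `N` is a smooth unit normal field along `f`. -/
def IsUnitNormal (f N : S2 → E3) : Prop :=
  ContMDiff (𝓡 2) 𝓘(ℝ, E3) ∞ N ∧
    ∀ p, ‖N p‖ = 1 ∧ ∀ v, inner ℝ (N p) (diff f p v) = 0

/-- The domain enclosed by a closed surface `S ⊂ ℝ³`: the union of the bounded connected
components of its complement. -/
def enclosedDomain (S : Set E3) : Set E3 :=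
  {x | x ∈ Sᶜ ∧ Bornology.IsBounded (connectedComponentIn Sᶜ x)}

/-- `N` is the outward pointing unit normal field of the embedded closed surface `f`. -/
def IsOutwardUnitNormal (f N : S2 → E3) : Prop :=
  IsUnitNormal f N ∧ ∀ p, ∀ᶠ s in 𝓝[>] (0 : ℝ),
    f p - s • N p ∈ enclosedDomain (range f) ∧
      f p + s • N p ∉ range f ∪ enclosedDomain (range f)

/-- A smooth solution `F : 𝕊² × [0, T) → ℝ³` of the constrained mean curvature flow
`∂F/∂t = (h - H) N`, `F(·, 0) = F₀`, with global term `h(t) = η (F(·, t)) (N(·, t))`. Here `F₀` is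
a closed embedded surface, every `F(·, t)` is an immersion, and `N` is the smooth unit normal field
along `F` that points outward at time `0`. -/
structure IsConstrainedMCF (η : (S2 → E3) → (S2 → E3) → ℝ) (F₀ : S2 → E3) (T : ℝ)
    (F N : ℝ → S2 → E3) : Prop where
  smooth : ContMDiffOn ((𝓡 2).prod 𝓘(ℝ, ℝ)) 𝓘(ℝ, E3) ∞
    (fun q : S2 × ℝ => F q.2 q.1) (univ ×ˢ Ico 0 T)
  smooth_normal : ContMDiffOn ((𝓡 2).prod 𝓘(ℝ, ℝ)) 𝓘(ℝ, E3) ∞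
    (fun q : S2 × ℝ => N q.2 q.1) (univ ×ˢ Ico 0 T)
  immersion : ∀ t ∈ Ico 0 T, IsSmoothImmersion (F t)
  normal : ∀ t ∈ Ico 0 T, IsUnitNormal (F t) (N t)
  outward : IsOutwardUnitNormal F₀ (N 0)
  initial : F 0 = F₀
  flow : ∀ t ∈ Ioo 0 T, ∀ p,
    HasDerivAt (fun s => F s p) ((η (F t) (N t) - meanCurvature (F t) (N t) p) • N t p) t

/-- Solutions of the volume preserving mean curvature flow on `[0, T)` starting at `F₀`. -/
def IsVPMCF (F₀ : S2 → E3) (T : ℝ) (F N : ℝ → S2 → E3) : Prop :=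
  IsConstrainedMCF vpTerm F₀ T F N

/-- Solutions of the area preserving mean curvature flow on `[0, T)` starting at `F₀`; the
denominator `∫ H dμ_t` of the global term is part of what has to make sense. -/
def IsAPMCF (F₀ : S2 → E3) (T : ℝ) (F N : ℝ → S2 → E3) : Prop :=
  IsConstrainedMCF apTerm F₀ T F N ∧ ∀ t ∈ Ico 0 T, totalMeanCurvature (F t) (N t) ≠ 0

/-- The set obtained by rotating about the `x₃`-axis the curve `z ↦ (r, x₃) = (ρ(z), z)`,
`z ∈ [-b, b]`. -/
def revolution (ρ : ℝ → ℝ) (b : ℝ) : Set E3 :=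
  {x | ∃ z ∈ Icc (-b) b, ∃ θ : ℝ, x = !₂[ρ z * Real.cos θ, ρ z * Real.sin θ, z]}

/-- The catenary `cosh z` for `|z| ≤ a`, bent by the factor `φ(|z|)` for `|z| > a`. -/
def bentCatenary (φ : ℝ → ℝ) (a : ℝ) (z : ℝ) : ℝ :=
  if |z| ≤ a then Real.cosh z else Real.cosh z * φ |z|

end ConstrainedMCF

end

/-! Where the initial surface is minimal on an open set, a constrained flow starts with velocity `c
N`, where `c = h(0)` is constant: to first order that region moves to a parallel surface. The
principal curvatures then change like `κ / (1 + tcκ)`, so `H` has initial rate `-c|A|²`; no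
Laplacian of `H` enters, since `H ≡ 0` nearby. If moreover `H ≥ 0` everywhere and `H > 0` somewhere,
both global terms are positive at time 0 (`exists_tendsto_globalTerm`), so `c > 0` and `H` turns
negative at once wherever `A ≠ 0`. At the waist of the catenoid the principal curvatures are `1` and
`-1` and the rate is `-2c` (`hasDerivWithinAt_quotient`,
`IsConstrainedMCF.eventually_meanCurvature_neg`).

The flow equation is only given for `t > 0`, so the initial velocity and the value `c` are obtained
as limits. This needs `H` and the area density to be continuous in space and time up to `t = 0`.
Maps on the sphere are therefore extended radially to `ℝ³ ∖ {0}`, and `H` and the density are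
rewritten by 3 × 3 matrices that do not involve a tangent frame (`fullMetric_det`,
`trace_fullMetric`).

The surface is the zero set of `x₁² + x₂² - R(x₃)` with `R = cosh² · q`. Here `q = bendSq` equals 1
for `|s| ≤ 1/2`, and on the caps it decreases in `|s|` and is concave, with a simple zero at `|s| =
1`. The numerator of `H` is `cosh² q (1 - q) + cosh⁴ (q'² - q q'') / 2` (`curvatureNum_eq`): zero on
the neck, positive on the caps. The zero of `q` at the poles being simple, `R(s) / (1 - s²)` is
smooth and positive, and stretching the round sphere horizontally by its square root is a smooth
embedding. -/

noncomputable section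

namespace ConstrainedMCF

/-! ### The radial retraction onto the sphere -/

/-- The radial retraction `x ↦ x / ‖x‖` of `ℝ³ ∖ {0}` onto the sphere. -/
def retract (x : E3) : S2 :=
  if h : x = 0 then ⟨EuclideanSpace.single 0 1, by simp⟩
  else ⟨‖x‖⁻¹ • x, by simp [norm_smul, h]⟩

theorem coe_retract {x : E3} (h : x ≠ 0) : (retract x : E3) = ‖x‖⁻¹ • x := by
  simp [retract, h]

theorem norm_coe_sphere (p : S2) : ‖(p : E3)‖ = 1 := by
  simp

theorem coe_sphere_ne_zero (p : S2) : (p : E3) ≠ 0 := by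
  intro h
  simpa [h] using norm_coe_sphere p

theorem retract_coe (p : S2) : retract (p : E3) = p := by
  ext1
  rw [coe_retract (coe_sphere_ne_zero p), norm_coe_sphere]
  simp

theorem contMDiffOn_retract : ContMDiffOn 𝓘(ℝ, E3) (𝓡 2) ∞ retract {0}ᶜ := by
  intro x hx
  apply ContMDiffAt.contMDiffWithinAt
  -- Smoothness of a corestriction to the sphere is a statement about maps smooth on a whole
  -- manifold, so the punctured space is treated as an open submanifold.
  let V : TopologicalSpace.Opens E3 := ⟨{0}ᶜ, isOpen_compl_singleton⟩
  have h1 : ContMDiff 𝓘(ℝ, E3) 𝓘(ℝ, E3) ∞ (fun y : V => ‖(y : E3)‖⁻¹ • (y : E3)) := by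
    intro y
    have hy : (y : E3) ≠ 0 := y.2
    have : ContMDiffAt 𝓘(ℝ, E3) 𝓘(ℝ, E3) ∞ (fun y : E3 => ‖y‖⁻¹ • y) (y : E3) := by
      apply ContDiffAt.contMDiffAt
      exact ((contDiffAt_norm ℝ hy).inv (by simpa using hy)).smul contDiffAt_id
    exact contMDiffAt_subtype_iff.2 this
  have : Fact (Module.finrank ℝ E3 = 2 + 1) := ⟨by simp⟩
  have h2 := h1.codRestrict_sphere (n := 2) (E := E3) (fun y => by
    have hy : (y : E3) ≠ 0 := y.2
    simp [norm_smul, hy])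
  refine (contMDiffAt_subtype_iff (U := V) (x := ⟨x, hx⟩)).1 ?_
  have h3 : (fun y : V => retract y) = codRestrict (fun y : V => ‖(y : E3)‖⁻¹ • (y : E3))
      (Metric.sphere (0 : E3) 1) (fun y => by
        have hy : (y : E3) ≠ 0 := y.2
        simp [norm_smul, hy]) := by
    ext1 y
    ext1
    exact coe_retract y.2
  rw [h3]
  exact h2 ⟨x, hx⟩

theorem contMDiff_coe : ContMDiff (𝓡 2) 𝓘(ℝ, E3) ∞ (fun q : S2 => (q : E3)) := by
  have : Fact (Module.finrank ℝ E3 = 2 + 1) := ⟨by simp⟩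
  exact contMDiff_coe_sphere

/-- The vectors of the coordinate frame at `p`, as vectors of `ℝ³`. -/
def frame (p : S2) (i : Fin 2) : E3 := diff (fun q : S2 => (q : E3)) p (tangentBasis i)

/-- The chain rule for the inclusion of the sphere; it turns every differential on the sphere into a
Fréchet derivative in `ℝ³` applied to a tangent vector. -/
theorem diff_comp_coe {f : S2 → E3} {g : E3 → E3} {L : E3 →L[ℝ] E3} {p : S2}
    (hg : HasFDerivAt g L (p : E3)) (hfg : ∀ q, f q = g q) (v : EuclideanSpace ℝ (Fin 2)) :
    diff f p v = L (diff (fun q : S2 => (q : E3)) p v) := by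
  have h1 : f = g ∘ (fun q : S2 => (q : E3)) := funext hfg
  have h2 : MDifferentiableAt (𝓡 2) 𝓘(ℝ, E3) (fun q : S2 => (q : E3)) p :=
    (contMDiff_coe p).mdifferentiableAt (by simp)
  have h3 := hg.hasMFDerivAt.comp p h2.hasMFDerivAt
  rw [← h1] at h3
  unfold diff
  rw [h3.mfderiv]
  rfl

theorem inner_diff_coe (p : S2) (v : EuclideanSpace ℝ (Fin 2)) :
    inner ℝ (p : E3) (diff (fun q : S2 => (q : E3)) p v) = 0 := by
  have : Fact (Module.finrank ℝ E3 = 2 + 1) := ⟨by simp⟩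
  have h1 := range_mvfderiv_subtypeVal (n := 2) p
  have h2 : diff (fun q : S2 => (q : E3)) p v ∈ (Submodule.span ℝ {(p : E3)})ᗮ := by
    rw [← h1]
    exact ⟨v, rfl⟩
  rwa [Submodule.mem_orthogonal_singleton_iff_inner_right] at h2

theorem injective_diff_coe (p : S2) : Function.Injective (diff (fun q : S2 => (q : E3)) p) := by
  have : Fact (Module.finrank ℝ E3 = 2 + 1) := ⟨by simp⟩
  exact injective_mvfderiv_subtypeVal_sphere (n := 2) p

/-- The radial extension of a smooth map on the sphere is smooth. -/
theorem contDiffOn_comp_retract {f : S2 → E3} (hf : ContMDiff (𝓡 2) 𝓘(ℝ, E3) ∞ f) :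
    ContDiffOn ℝ ∞ (fun x => f (retract x)) {0}ᶜ := by
  rw [← contMDiffOn_iff_contDiffOn]
  exact hf.comp_contMDiffOn contMDiffOn_retract

/-- The radial extension of a smooth family of maps on the sphere is smooth. -/
theorem contDiffOn_comp_retract_prod {F : ℝ → S2 → E3} {I : Set ℝ}
    (hF : ContMDiffOn ((𝓡 2).prod 𝓘(ℝ, ℝ)) 𝓘(ℝ, E3) ∞ (fun q : S2 × ℝ => F q.2 q.1) (univ ×ˢ I)) :
    ContDiffOn ℝ ∞ (fun y : E3 × ℝ => F y.2 (retract y.1)) ({0}ᶜ ×ˢ I) := by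
  rw [← contMDiffOn_iff_contDiffOn]
  have h1 : ContMDiffOn 𝓘(ℝ, E3 × ℝ) (𝓡 2) ∞ (fun y : E3 × ℝ => retract y.1)
      (({0}ᶜ : Set E3) ×ˢ I) :=
    contMDiffOn_retract.comp contDiff_fst.contMDiff.contMDiffOn (fun y hy => hy.1)
  have h2 : ContMDiffOn 𝓘(ℝ, E3 × ℝ) 𝓘(ℝ, ℝ) ∞ (fun y : E3 × ℝ => y.2)
      (({0}ᶜ : Set E3) ×ˢ I) := contDiff_snd.contMDiff.contMDiffOn
  exact hF.comp (h1.prodMk h2) (fun y hy => ⟨mem_univ _, hy.2⟩)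

/-- If `f` is smooth, its radial extension is differentiable at the points of the sphere. -/
theorem differentiableAt_comp_retract {f : S2 → E3} (hf : ContMDiff (𝓡 2) 𝓘(ℝ, E3) ∞ f)
    (p : S2) : DifferentiableAt ℝ (fun x => f (retract x)) (p : E3) :=
  ((contDiffOn_comp_retract hf).contDiffAt
    (isOpen_compl_singleton.mem_nhds (coe_sphere_ne_zero p))).differentiableAt (by simp)

theorem diff_eq_fderiv_retract {f : S2 → E3} (hf : ContMDiff (𝓡 2) 𝓘(ℝ, E3) ∞ f) (p : S2)
    (v : EuclideanSpace ℝ (Fin 2)) :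
    diff f p v = fderiv ℝ (fun x => f (retract x)) p (diff (fun q : S2 => (q : E3)) p v) :=
  diff_comp_coe (differentiableAt_comp_retract hf p).hasFDerivAt
    (fun q => by simp [retract_coe]) v

/-- The radial extension is constant along rays. The resulting kernel direction `p` is what
`fullMetric` fills in. -/
theorem fderiv_retract_self {f : S2 → E3} (hf : ContMDiff (𝓡 2) 𝓘(ℝ, E3) ∞ f) (p : S2) :
    fderiv ℝ (fun x => f (retract x)) p (p : E3) = 0 := by
  have h1 := (differentiableAt_comp_retract hf p).hasFDerivAt
  have h2 : HasDerivAt (fun s : ℝ => s • (p : E3)) (p : E3) 1 := by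
    simpa using (hasDerivAt_id (1 : ℝ)).smul_const (p : E3)
  have h3 : HasDerivAt (fun s : ℝ => f (retract (s • (p : E3))))
      (fderiv ℝ (fun x => f (retract x)) p (p : E3)) 1 := by
    refine HasFDerivAt.comp_hasDerivAt (1 : ℝ) (l := fun x => f (retract x)) ?_ h2
    simpa using h1
  have h4 : (fun s : ℝ => f (retract (s • (p : E3)))) =ᶠ[𝓝 1] fun _ => f p := by
    filter_upwards [lt_mem_nhds (zero_lt_one (α := ℝ))] with s hs
    congr 1
    ext1
    have hs' : s • (p : E3) ≠ 0 := smul_ne_zero hs.ne' (coe_sphere_ne_zero p)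
    rw [coe_retract hs', norm_smul, norm_coe_sphere, smul_smul, Real.norm_of_nonneg hs.le]
    field_simp
    simp
  exact h3.unique ((hasDerivAt_const (1 : ℝ) (f p)).congr_of_eventuallyEq h4)

/-! ### Frame-independent formulas for the mean curvature and the area density -/

/-- The matrix of the bilinear form `(x, y) ↦ ⟨A x, B y⟩` in the standard basis of `ℝ³`. -/
def formMatrix (A B : E3 →L[ℝ] E3) : Matrix (Fin 3) (Fin 3) ℝ :=
  Matrix.of fun j k => inner ℝ (A (EuclideanSpace.single j 1)) (B (EuclideanSpace.single k 1))

/-- The matrix of the metric of `L`, completed by the square of the dual of `p`. -/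
def fullMetric (L : E3 →L[ℝ] E3) (p : E3) : Matrix (Fin 3) (Fin 3) ℝ :=
  formMatrix L L + Matrix.of fun j k => p j * p k

theorem sum_smul_single (x : E3) : x = ∑ j, x j • EuclideanSpace.single j (1 : ℝ) := by
  ext i
  fin_cases i <;> simp [Fin.sum_univ_three]

theorem mul_formMatrix_mul (A B : E3 →L[ℝ] E3) (a : Fin 3 → E3) :
    Matrix.of (fun i j => a i j) * formMatrix A B * (Matrix.of fun i j => a i j).transpose =
      Matrix.of fun i l => inner ℝ (A (a i)) (B (a l)) := by
  ext i l
  have h1 : ∀ x, A x = ∑ j, x j • A (EuclideanSpace.single j (1 : ℝ)) := fun x => by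
    conv_lhs => rw [sum_smul_single x]
    simp [map_sum]
  have h2 : ∀ x, B x = ∑ j, x j • B (EuclideanSpace.single j (1 : ℝ)) := fun x => by
    conv_lhs => rw [sum_smul_single x]
    simp [map_sum]
  rw [Matrix.of_apply, h1 (a i), h2 (a l)]
  simp only [Matrix.mul_apply, formMatrix, Matrix.of_apply, Matrix.transpose_apply,
    Fin.sum_univ_three, inner_add_left, inner_add_right, real_inner_smul_left,
    real_inner_smul_right]
  ring

/-- The coordinate frame at `p`, completed by the position vector `p`. -/
def fullFrame (p : S2) : Fin 3 → E3 := ![frame p 0, frame p 1, p]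

/-- The matrix whose rows are the vectors of `fullFrame p`. -/
def frameMatrix (p : S2) : Matrix (Fin 3) (Fin 3) ℝ := Matrix.of fun i j => fullFrame p i j

theorem inner_coe_frame (p : S2) (i : Fin 2) : inner ℝ (p : E3) (frame p i) = 0 :=
  inner_diff_coe p _

theorem inner_frame_coe (p : S2) (i : Fin 2) : inner ℝ (frame p i) (p : E3) = 0 := by
  rw [real_inner_comm]; exact inner_coe_frame p i

theorem gram_det_pos {a b : E3} (h : ∀ x y : ℝ, x • a + y • b = 0 → x = 0 ∧ y = 0) :
    0 < inner ℝ a a * inner ℝ b b - inner ℝ a b * inner ℝ a b := by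
  have hb : b ≠ 0 := fun hb => by simpa using (h 0 1 (by simp [hb])).2
  have hb' : 0 < inner ℝ b b := real_inner_self_pos.2 hb
  -- This is `⟨b,b⟩` times the part of `a` orthogonal to `b`; its squared norm is `⟨b,b⟩` times the
  -- Gram determinant.
  have h1 : inner ℝ b b • a + (-inner ℝ a b) • b ≠ 0 := fun h0 => hb'.ne' (h _ _ h0).1
  have h2 := real_inner_self_pos.2 h1
  simp only [inner_add_left, inner_add_right, real_inner_smul_left, real_inner_smul_right,
    real_inner_comm a b] at h2
  have h3 : 0 < inner ℝ b b * (inner ℝ a a * inner ℝ b b - inner ℝ a b * inner ℝ a b) := by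
    linarith
  exact pos_of_mul_pos_right h3 hb'.le

theorem tangent_combination (x y : ℝ) (L : EuclideanSpace ℝ (Fin 2) →L[ℝ] E3) :
    x • L (tangentBasis 0) + y • L (tangentBasis 1) = L !₂[x, y] := by
  rw [← map_smul, ← map_smul, ← map_add]
  congr 1
  ext i
  fin_cases i <;> simp [tangentBasis]

theorem inducedMetric_det (f : S2 → E3) (p : S2) : (inducedMetric f p).det =
    inner ℝ (diff f p (tangentBasis 0)) (diff f p (tangentBasis 0)) *
      inner ℝ (diff f p (tangentBasis 1)) (diff f p (tangentBasis 1)) -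
    inner ℝ (diff f p (tangentBasis 0)) (diff f p (tangentBasis 1)) *
      inner ℝ (diff f p (tangentBasis 0)) (diff f p (tangentBasis 1)) := by
  rw [Matrix.det_fin_two]
  simp only [inducedMetric, Matrix.of_apply]
  rw [real_inner_comm (diff f p (tangentBasis 0)) (diff f p (tangentBasis 1))]

theorem inducedMetric_det_pos {f : S2 → E3} {p : S2} (h : Function.Injective (diff f p)) :
    0 < (inducedMetric f p).det := by
  rw [inducedMetric_det]
  apply gram_det_pos
  intro x y hxy
  rw [tangent_combination] at hxy
  have h1 := (map_eq_zero_iff (diff f p) h).1 hxy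
  exact ⟨by simpa using congrArg (fun v => v 0) h1, by simpa using congrArg (fun v => v 1) h1⟩

/-- The mean curvature as an explicit rational expression in a frame. -/
theorem meanCurvature_eq (f N : S2 → E3) (p : S2) : meanCurvature f N p =
    (inducedMetric f p 1 1 * secondFundamentalForm f N p 0 0
      - inducedMetric f p 0 1 * secondFundamentalForm f N p 1 0
      - inducedMetric f p 1 0 * secondFundamentalForm f N p 0 1
      + inducedMetric f p 0 0 * secondFundamentalForm f N p 1 1) / (inducedMetric f p).det := by
  rw [meanCurvature, Matrix.inv_def, Ring.inverse_eq_inv', Matrix.adjugate_fin_two,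
    Matrix.trace_fin_two]
  simp only [Matrix.smul_apply, Matrix.mul_apply, Fin.sum_univ_two]
  simp
  ring

section
variable {f N : S2 → E3} {p : S2} {L M : E3 →L[ℝ] E3}
  (hL : ∀ v, diff f p v = L (diff (fun q : S2 => (q : E3)) p v)) (hLp : L p = 0)
  (hM : ∀ v, diff N p v = M (diff (fun q : S2 => (q : E3)) p v))

theorem frameMatrix_mul_transpose (p : S2) : frameMatrix p * (frameMatrix p).transpose =
    Matrix.of fun i l => inner ℝ (fullFrame p i) (fullFrame p l) := by
  have h := mul_formMatrix_mul (ContinuousLinearMap.id ℝ E3) (ContinuousLinearMap.id ℝ E3)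
    (fullFrame p)
  have h1 : formMatrix (ContinuousLinearMap.id ℝ E3) (ContinuousLinearMap.id ℝ E3) = 1 := by
    ext i j
    fin_cases i <;> fin_cases j <;> simp [formMatrix, EuclideanSpace.inner_single_left]
  rw [h1, Matrix.mul_one] at h
  exact h

theorem inducedMetric_coe_apply (p : S2) (i j : Fin 2) :
    inducedMetric (fun q : S2 => (q : E3)) p i j = inner ℝ (frame p i) (frame p j) := rfl

include hL in
theorem inducedMetric_apply (i j : Fin 2) :
    inducedMetric f p i j = inner ℝ (L (frame p i)) (L (frame p j)) := by
  simp only [inducedMetric, Matrix.of_apply, hL]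
  rfl

include hL hM in
theorem secondFundamentalForm_apply (i j : Fin 2) :
    secondFundamentalForm f N p i j = inner ℝ (M (frame p i)) (L (frame p j)) := by
  simp only [secondFundamentalForm, Matrix.of_apply, hL, hM]
  rfl

/-- The position vector is a unit vector orthogonal to the frame, so the Gram matrix of the
completed frame is the round metric plus a block 1. -/
theorem frameMatrix_det_sq (p : S2) :
    (frameMatrix p).det * (frameMatrix p).det = (inducedMetric (fun q : S2 => (q : E3)) p).det := by
  have h := congrArg Matrix.det (frameMatrix_mul_transpose p)
  rw [Matrix.det_mul, Matrix.det_transpose] at h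
  rw [h, Matrix.det_fin_three, Matrix.det_fin_two]
  simp [fullFrame, inner_coe_frame, inner_frame_coe, inducedMetric_coe_apply]

theorem frameMatrix_det_ne_zero (p : S2) : (frameMatrix p).det ≠ 0 := by
  have h := inducedMetric_det_pos (injective_diff_coe p)
  rw [← frameMatrix_det_sq] at h
  intro h0
  simp [h0] at h

-- The frame at `p` comes from a chart chosen at `p`, and no frame is continuous on the whole
-- sphere, so the entries `g_ij` cannot be used for continuity in `p`. The matrix `fullMetric L p`
-- depends on `L` and `p` alone, and conjugating it with the frame recovers `g`; the summand `p ⊗ p`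
-- makes it invertible although `L p = 0`.
include hL hLp in
theorem frameMatrix_mul_fullMetric :
    frameMatrix p * fullMetric L p * (frameMatrix p).transpose =
      !![inducedMetric f p 0 0, inducedMetric f p 0 1, 0;
         inducedMetric f p 1 0, inducedMetric f p 1 1, 0;
         0, 0, 1] := by
  have h2 : frameMatrix p * (Matrix.of fun j k => (p : E3) j * (p : E3) k) *
      (frameMatrix p).transpose =
      Matrix.of fun i l => inner ℝ (fullFrame p i) (p : E3) * inner ℝ (fullFrame p l) (p : E3) := by
    ext i l
    simp only [Matrix.mul_apply, frameMatrix, Matrix.of_apply, Matrix.transpose_apply,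
      Fin.sum_univ_three, PiLp.inner_apply, RCLike.inner_apply, conj_trivial]
    ring
  rw [fullMetric, Matrix.mul_add, Matrix.add_mul, h2, frameMatrix, mul_formMatrix_mul]
  ext i l
  fin_cases i <;> fin_cases l <;>
    simp [fullFrame, inner_frame_coe, hLp, inducedMetric_apply hL]

include hL hLp hM in
theorem frameMatrix_mul_formMatrix (hMp : M p = 0) :
    frameMatrix p * formMatrix M L * (frameMatrix p).transpose =
      !![secondFundamentalForm f N p 0 0, secondFundamentalForm f N p 0 1, 0;
         secondFundamentalForm f N p 1 0, secondFundamentalForm f N p 1 1, 0;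
         0, 0, 0] := by
  rw [frameMatrix, mul_formMatrix_mul]
  ext i l
  fin_cases i <;> fin_cases l <;>
    simp [fullFrame, hLp, hMp, secondFundamentalForm_apply hL hM]

-- Both metrics pick up the same factor `(det W)²`, `W` the frame matrix, so the ratio of
-- determinants is free of the frame.
include hL hLp in
theorem fullMetric_det : (fullMetric L p).det =
    (inducedMetric f p).det / (inducedMetric (fun q : S2 => (q : E3)) p).det := by
  have h := congrArg Matrix.det (frameMatrix_mul_fullMetric hL hLp)
  rw [Matrix.det_mul, Matrix.det_mul, Matrix.det_transpose,
    Matrix.det_fin_three (Matrix.of ![![_, _, _], _, _])] at h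
  rw [eq_div_iff (inducedMetric_det_pos (injective_diff_coe p)).ne', ← frameMatrix_det_sq,
    Matrix.det_fin_two]
  simp at h
  linarith

-- With `W` the frame matrix, `(W G Wᵀ)⁻¹ (W B Wᵀ)` is conjugate to `G⁻¹ B`, so the trace does not
-- see the frame; the extra block contributes 0 because `M p = 0`. Writing the inverse as adjugate
-- over determinant leaves a quotient of polynomials in the entries.
include hL hLp hM in
theorem trace_fullMetric (hMp : M p = 0) (hf : Function.Injective (diff f p)) :
    ((fullMetric L p).adjugate * formMatrix M L).trace / (fullMetric L p).det =
      meanCurvature f N p := by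
  have hW : IsUnit (frameMatrix p).det := (frameMatrix_det_ne_zero p).isUnit
  have hg := (inducedMetric_det_pos hf).ne'
  have h1 : ((fullMetric L p).adjugate * formMatrix M L).trace / (fullMetric L p).det =
      ((fullMetric L p)⁻¹ * formMatrix M L).trace := by
    rw [Matrix.inv_def, Ring.inverse_eq_inv', Matrix.smul_mul, Matrix.trace_smul, smul_eq_mul]
    ring
  have h2 : ((fullMetric L p)⁻¹ * formMatrix M L).trace =
      ((frameMatrix p * fullMetric L p * (frameMatrix p).transpose)⁻¹ *
        (frameMatrix p * formMatrix M L * (frameMatrix p).transpose)).trace := by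
    have hW' : IsUnit (frameMatrix p).transpose.det := by rwa [Matrix.det_transpose]
    rw [Matrix.mul_inv_rev, Matrix.mul_inv_rev]
    have : (frameMatrix p).transpose⁻¹ * ((fullMetric L p)⁻¹ * (frameMatrix p)⁻¹) *
        (frameMatrix p * formMatrix M L * (frameMatrix p).transpose) =
        (frameMatrix p).transpose⁻¹ * ((fullMetric L p)⁻¹ * ((frameMatrix p)⁻¹ *
        frameMatrix p) * formMatrix M L * (frameMatrix p).transpose) := by
      simp only [Matrix.mul_assoc]
    rw [this, Matrix.nonsing_inv_mul _ hW, Matrix.mul_one,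
      Matrix.trace_mul_comm (frameMatrix p).transpose⁻¹,
      Matrix.mul_assoc, Matrix.mul_nonsing_inv _ hW', Matrix.mul_one]
  have hdet := Matrix.det_fin_two (inducedMetric f p)
  have h3 : (frameMatrix p * fullMetric L p * (frameMatrix p).transpose)⁻¹ =
      !![inducedMetric f p 1 1 / (inducedMetric f p).det,
          -inducedMetric f p 0 1 / (inducedMetric f p).det, 0;
         -inducedMetric f p 1 0 / (inducedMetric f p).det,
          inducedMetric f p 0 0 / (inducedMetric f p).det, 0;
         0, 0, 1] := by
    apply Matrix.inv_eq_right_inv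
    rw [frameMatrix_mul_fullMetric hL hLp]
    ext i l
    fin_cases i <;> fin_cases l <;> simp [Matrix.mul_apply, Fin.sum_univ_three] <;>
      field_simp <;> rw [hdet] <;> ring
  rw [h1, h2, h3, frameMatrix_mul_formMatrix hL hLp hM hMp, meanCurvature_eq,
    Matrix.trace_fin_three]
  simp [Matrix.mul_apply, Fin.sum_univ_three]
  field_simp
  ring

end

/-! ### Smooth families of surfaces: continuity in space and time -/

/-- `F` is smooth as a map on `𝕊² × I`. -/
def IsSmoothFamily (F : ℝ → S2 → E3) (I : Set ℝ) : Prop :=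
  ContMDiffOn ((𝓡 2).prod 𝓘(ℝ, ℝ)) 𝓘(ℝ, E3) ∞ (fun q : S2 × ℝ => F q.2 q.1) (univ ×ˢ I)

/-- The radial extension of a family of maps on the sphere. -/
def radialExtension (F : ℝ → S2 → E3) (y : E3 × ℝ) : E3 := F y.2 (retract y.1)

/-- The set `(ℝ³ ∖ {0}) × I`. -/
abbrev punctured (I : Set ℝ) : Set (E3 × ℝ) := {0}ᶜ ×ˢ I

/-- The spatial derivative of the radial extension. -/
def spaceDeriv (F : ℝ → S2 → E3) (I : Set ℝ) (y : E3 × ℝ) : E3 →L[ℝ] E3 :=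
  (fderivWithin ℝ (radialExtension F) (punctured I) y).comp (ContinuousLinearMap.inl ℝ E3 ℝ)

/-- The time derivative of the radial extension. -/
def timeDeriv (F : ℝ → S2 → E3) (I : Set ℝ) (y : E3 × ℝ) : E3 :=
  fderivWithin ℝ (radialExtension F) (punctured I) y (0, 1)

section
variable {F N : ℝ → S2 → E3} {I : Set ℝ} (hI : UniqueDiffOn ℝ I)
  (hF : IsSmoothFamily F I) (hN : IsSmoothFamily N I)

include hI in
theorem uniqueDiffOn_punctured : UniqueDiffOn ℝ (punctured I) :=
  isOpen_compl_singleton.uniqueDiffOn.prod hI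

theorem mem_punctured (p : S2) {t : ℝ} (ht : t ∈ I) : ((p : E3), t) ∈ punctured I :=
  ⟨coe_sphere_ne_zero p, ht⟩

include hF in
theorem IsSmoothFamily.contDiffOn : ContDiffOn ℝ ∞ (radialExtension F) (punctured I) :=
  contDiffOn_comp_retract_prod hF

include hI hF in
theorem IsSmoothFamily.continuousOn_fderivWithin :
    ContinuousOn (fderivWithin ℝ (radialExtension F) (punctured I)) (punctured I) :=
  hF.contDiffOn.continuousOn_fderivWithin (uniqueDiffOn_punctured hI) (by simp)

include hI hF in
theorem IsSmoothFamily.continuousOn_spaceDeriv :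
    ContinuousOn (spaceDeriv F I) (punctured I) :=
  (hF.continuousOn_fderivWithin hI).clm_comp continuousOn_const

include hI hF in
theorem IsSmoothFamily.continuousOn_timeDeriv :
    ContinuousOn (timeDeriv F I) (punctured I) :=
  (hF.continuousOn_fderivWithin hI).clm_apply continuousOn_const

include hF in
theorem IsSmoothFamily.hasFDerivWithinAt {y : E3 × ℝ} (hy : y ∈ punctured I) :
    HasFDerivWithinAt (radialExtension F) (fderivWithin ℝ (radialExtension F) (punctured I) y)
      (punctured I) y :=
  ((hF.contDiffOn y hy).differentiableWithinAt (by simp)).hasFDerivWithinAt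

include hF in
theorem IsSmoothFamily.hasFDerivAt_space {x : E3} {t : ℝ} (hx : x ≠ 0) (ht : t ∈ I) :
    HasFDerivAt (fun x => F t (retract x)) (spaceDeriv F I (x, t)) x := by
  have h1 := hF.hasFDerivWithinAt (y := (x, t)) ⟨hx, ht⟩
  have h2 : HasFDerivWithinAt (fun x : E3 => (x, t)) (ContinuousLinearMap.inl ℝ E3 ℝ) {0}ᶜ x :=
    (hasFDerivAt_prodMk_left x t).hasFDerivWithinAt
  have h3 := h1.comp x h2 fun z hz => mk_mem_prod hz ht
  exact h3.hasFDerivAt (isOpen_compl_singleton.mem_nhds hx)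

include hF in
theorem IsSmoothFamily.hasDerivWithinAt_time {x : E3} {t : ℝ} (hx : x ≠ 0) (ht : t ∈ I) :
    HasDerivWithinAt (fun s => F s (retract x)) (timeDeriv F I (x, t)) I t := by
  have h1 := hF.hasFDerivWithinAt (y := (x, t)) ⟨hx, ht⟩
  have h2 : HasDerivWithinAt (fun s : ℝ => (x, s)) ((0 : E3), (1 : ℝ)) I t :=
    ((hasDerivWithinAt_const t I x).prodMk (hasDerivWithinAt_id t I))
  exact h1.comp_hasDerivWithinAt t h2 fun z hz => mk_mem_prod hx hz

include hF in
theorem IsSmoothFamily.diff_eq (p : S2) {t : ℝ} (ht : t ∈ I) (v : EuclideanSpace ℝ (Fin 2)) :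
    diff (F t) p v = spaceDeriv F I (p, t) (diff (fun q : S2 => (q : E3)) p v) :=
  diff_comp_coe (hF.hasFDerivAt_space (coe_sphere_ne_zero p) ht)
    (fun q => by simp [retract_coe]) v

include hF in
theorem IsSmoothFamily.spaceDeriv_self (p : S2) {t : ℝ} (ht : t ∈ I)
    (h : ContMDiff (𝓡 2) 𝓘(ℝ, E3) ∞ (F t)) : spaceDeriv F I (p, t) p = 0 := by
  rw [← (hF.hasFDerivAt_space (coe_sphere_ne_zero p) ht).fderiv]
  exact fderiv_retract_self h p

theorem continuousOn_coe_prod :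
    ContinuousOn (fun q : S2 × ℝ => ((q.1 : E3), q.2)) (univ ×ˢ I) := by fun_prop

include hI hF in
theorem IsSmoothFamily.continuousOn_spaceDeriv_coe :
    ContinuousOn (fun q : S2 × ℝ => spaceDeriv F I (q.1, q.2)) (univ ×ˢ I) :=
  (hF.continuousOn_spaceDeriv hI).comp continuousOn_coe_prod (fun q hq => mem_punctured q.1 hq.2)

theorem continuous_formMatrix :
    Continuous (fun q : (E3 →L[ℝ] E3) × (E3 →L[ℝ] E3) => formMatrix q.1 q.2) := by
  refine continuous_matrix fun i j => ?_
  simp only [formMatrix, Matrix.of_apply]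
  fun_prop

theorem continuous_fullMetric :
    Continuous (fun q : (E3 →L[ℝ] E3) × E3 => fullMetric q.1 q.2) := by
  have h1 : Continuous (fun q : (E3 →L[ℝ] E3) × E3 => formMatrix q.1 q.1) :=
    continuous_formMatrix.comp (continuous_fst.prodMk continuous_fst)
  refine h1.add (continuous_matrix fun i j => ?_)
  simp only [Matrix.of_apply]
  fun_prop

/-- The density of the area measure with respect to the round area measure. -/
def areaDensity (f : S2 → E3) (p : S2) : ℝ :=
  √((inducedMetric f p).det / (inducedMetric (fun q : S2 => (q : E3)) p).det)

theorem areaDensity_pos {f : S2 → E3} (hf : IsSmoothImmersion f) (p : S2) :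
    0 < areaDensity f p :=
  Real.sqrt_pos.2 (div_pos (inducedMetric_det_pos (hf.2 p))
    (inducedMetric_det_pos (injective_diff_coe p)))

include hI hF in
theorem continuousOn_fullMetric :
    ContinuousOn (fun q : S2 × ℝ => fullMetric (spaceDeriv F I (q.1, q.2)) q.1) (univ ×ˢ I) := by
  have h1 : ContinuousOn (fun q : S2 × ℝ => (q.1 : E3)) (univ ×ˢ I) := by fun_prop
  have h2 := (hF.continuousOn_spaceDeriv_coe hI).prodMk h1
  have h3 := continuous_fullMetric.comp_continuousOn h2
  simp only [Function.comp_def] at h3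
  exact h3

include hI hF in
theorem continuousOn_det_fullMetric : ContinuousOn (fun q : S2 × ℝ =>
    (fullMetric (spaceDeriv F I (q.1, q.2)) q.1).det) (univ ×ˢ I) := by
  have h1 : Continuous (fun A : Matrix (Fin 3) (Fin 3) ℝ => A.det) := continuous_id.matrix_det
  exact h1.comp_continuousOn (continuousOn_fullMetric hI hF)

include hI hF in
theorem continuousOn_areaDensity (hFt : ∀ t ∈ I, IsSmoothImmersion (F t)) :
    ContinuousOn (fun q : S2 × ℝ => areaDensity (F q.2) q.1) (univ ×ˢ I) := by
  have h1 := (continuousOn_det_fullMetric hI hF).sqrt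
  refine h1.congr fun q hq => ?_
  simp only
  rw [areaDensity, fullMetric_det (hF.diff_eq q.1 hq.2) (hF.spaceDeriv_self q.1 hq.2 (hFt _ hq.2).1)]

include hI hF hN in
theorem continuousOn_meanCurvature (hFt : ∀ t ∈ I, IsSmoothImmersion (F t))
    (hNt : ∀ t ∈ I, ContMDiff (𝓡 2) 𝓘(ℝ, E3) ∞ (N t)) :
    ContinuousOn (fun q : S2 × ℝ => meanCurvature (F q.2) (N q.2) q.1) (univ ×ˢ I) := by
  have h1 := continuousOn_fullMetric hI hF
  have h2 := continuous_formMatrix.comp_continuousOn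
    ((hN.continuousOn_spaceDeriv_coe hI).prodMk (hF.continuousOn_spaceDeriv_coe hI))
  have h3 : Continuous (fun q : Matrix (Fin 3) (Fin 3) ℝ × Matrix (Fin 3) (Fin 3) ℝ =>
      (q.1.adjugate * q.2).trace) :=
    (continuous_fst.matrix_adjugate.matrix_mul continuous_snd).matrix_trace
  have h5 := (h3.comp_continuousOn (h1.prodMk h2)).div (continuousOn_det_fullMetric hI hF) (fun q hq => by
    rw [fullMetric_det (hF.diff_eq q.1 hq.2) (hF.spaceDeriv_self q.1 hq.2 (hFt _ hq.2).1)]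
    exact (div_pos (inducedMetric_det_pos ((hFt _ hq.2).2 _))
      (inducedMetric_det_pos (injective_diff_coe _))).ne')
  refine h5.congr fun q hq => ?_
  exact (trace_fullMetric (hF.diff_eq q.1 hq.2) (hF.spaceDeriv_self q.1 hq.2 (hFt _ hq.2).1)
    (hN.diff_eq q.1 hq.2) (hN.spaceDeriv_self q.1 hq.2 (hNt _ hq.2)) ((hFt _ hq.2).2 _)).symm

/-! ### Continuity of the global terms -/

/-- Moves the dependence on `f` from the measure to the integrand, so that the global terms become
parameter integrals over a fixed finite measure. -/
theorem integral_areaMeasure {f : S2 → E3} (hf : Continuous (areaDensity f)) (g : S2 → ℝ) :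
    ∫ p, g p ∂(areaMeasure f) = ∫ p, areaDensity f p * g p ∂((volume : Measure E3).toSphere) := by
  rw [areaMeasure, integral_withDensity_eq_integral_toReal_smul]
  · simp only [smul_eq_mul]
    congr 1 with p
    rw [ENNReal.toReal_ofReal (Real.sqrt_nonneg _), areaDensity]
  · exact hf.measurable.ennreal_ofReal
  · exact Eventually.of_forall fun p => ENNReal.ofReal_lt_top

theorem area_eq {f : S2 → E3} (hf : Continuous (areaDensity f)) :
    area f = ∫ p, areaDensity f p ∂((volume : Measure E3).toSphere) := by
  have := integral_areaMeasure hf (fun _ => 1)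
  simpa [area] using this

theorem continuous_slice {E : Type*} [TopologicalSpace E] {u : S2 × ℝ → E}
    (hu : ContinuousOn u (univ ×ˢ I)) {t : ℝ} (ht : t ∈ I) : Continuous fun p => u (p, t) :=
  hu.comp_continuous (by fun_prop) (fun p => ⟨mem_univ _, ht⟩)

theorem continuousOn_integral_slice (hl : IsLocallyClosed I) {u : S2 × ℝ → ℝ}
    (hu : ContinuousOn u (univ ×ˢ I)) :
    ContinuousOn (fun t => ∫ p, u (p, t) ∂((volume : Measure E3).toSphere)) I := by
  have : LocallyCompactSpace I := hl.locallyCompactSpace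
  rw [continuousOn_iff_continuous_domRestrict]
  have h1 : Continuous (Function.uncurry fun (t : I) (p : S2) => u (p, t)) :=
    hu.comp_continuous (f := fun q : I × S2 => (q.2, (q.1 : ℝ))) (by fun_prop)
      (fun q => ⟨mem_univ _, q.1.2⟩)
  have h2 := continuous_parametric_integral_of_continuous
    (μ := (volume : Measure E3).toSphere) h1 (isCompact_univ (X := S2))
  simp only [Measure.restrict_univ] at h2
  exact h2

theorem integral_sphere_pos {g : S2 → ℝ} (hg : Continuous g) (h0 : ∀ p, 0 ≤ g p) {p : S2}
    (hp : 0 < g p) : 0 < ∫ p, g p ∂((volume : Measure E3).toSphere) :=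
  hg.integral_pos_of_hasCompactSupport_nonneg_nonzero (HasCompactSupport.of_compactSpace g) h0 hp.ne'

include hI hF hN in
/-- Along a smooth family of immersions that is mean convex, but not minimal, at time `0`, the global
terms of both flows converge to a positive number as `t → 0`. -/
theorem exists_tendsto_globalTerm (hl : IsLocallyClosed I)
    (hFt : ∀ t ∈ I, IsSmoothImmersion (F t))
    (hNt : ∀ t ∈ I, ContMDiff (𝓡 2) 𝓘(ℝ, E3) ∞ (N t)) (h0 : 0 ∈ I)
    (hH : ∀ p, 0 ≤ meanCurvature (F 0) (N 0) p) {p : S2} (hp : 0 < meanCurvature (F 0) (N 0) p) :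
    (∃ c, 0 < c ∧ Tendsto (fun t => vpTerm (F t) (N t)) (𝓝[I] 0) (𝓝 c)) ∧
      ∃ c, 0 < c ∧ Tendsto (fun t => apTerm (F t) (N t)) (𝓝[I] 0) (𝓝 c) := by
  have hW := continuousOn_areaDensity hI hF hFt
  have hC := continuousOn_meanCurvature hI hF hN hFt hNt
  have hWt : ∀ t ∈ I, Continuous (areaDensity (F t)) := fun t ht => continuous_slice hW ht
  have e1 : ∀ t ∈ I, totalMeanCurvature (F t) (N t) = ∫ p, areaDensity (F t) p *
      meanCurvature (F t) (N t) p ∂((volume : Measure E3).toSphere) :=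
    fun t ht => integral_areaMeasure (hWt t ht) _
  have e2 : ∀ t ∈ I, ∫ p, meanCurvature (F t) (N t) p ^ 2 ∂(areaMeasure (F t)) =
      ∫ p, areaDensity (F t) p * meanCurvature (F t) (N t) p ^ 2
        ∂((volume : Measure E3).toSphere) :=
    fun t ht => integral_areaMeasure (hWt t ht) _
  have c1 : ContinuousOn (fun t => totalMeanCurvature (F t) (N t)) I :=
    (continuousOn_integral_slice hl (hW.mul hC)).congr e1
  have c2 : ContinuousOn (fun t => ∫ p, meanCurvature (F t) (N t) p ^ 2 ∂(areaMeasure (F t))) I :=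
    (continuousOn_integral_slice hl (hW.mul (hC.pow 2))).congr e2
  have c3 : ContinuousOn (fun t => area (F t)) I :=
    (continuousOn_integral_slice hl hW).congr fun t ht => area_eq (hWt t ht)
  have hW0 := hWt 0 h0
  have hC0 : Continuous (meanCurvature (F 0) (N 0)) := continuous_slice hC h0
  have hWp : ∀ q, 0 < areaDensity (F 0) q := areaDensity_pos (hFt 0 h0)
  have p1 : 0 < totalMeanCurvature (F 0) (N 0) := by
    rw [e1 0 h0]
    exact integral_sphere_pos (hW0.mul hC0) (fun q => mul_nonneg (hWp q).le (hH q))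
      (mul_pos (hWp p) hp)
  have p2 : 0 < ∫ p, meanCurvature (F 0) (N 0) p ^ 2 ∂(areaMeasure (F 0)) := by
    rw [e2 0 h0]
    exact integral_sphere_pos (hW0.mul (hC0.pow 2))
      (fun q => mul_nonneg (hWp q).le (sq_nonneg _)) (mul_pos (hWp p) (pow_pos hp 2))
  have p3 : 0 < area (F 0) := by
    rw [area_eq hW0]
    exact integral_sphere_pos hW0 (fun q => (hWp q).le) (hWp p)
  exact ⟨⟨_, div_pos p1 p3, (c1 0 h0).div (c3 0 h0) p3.ne'⟩,
    ⟨_, div_pos p2 p1, (c2 0 h0).div (c1 0 h0) p1.ne'⟩⟩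

end

/-! ### First variation of the mean curvature at the initial time -/

theorem exists_decomposition {a b n : E3} (h : ∀ x y : ℝ, x • a + y • b = 0 → x = 0 ∧ y = 0)
    (hn : n ≠ 0) (ha : inner ℝ n a = 0) (hb : inner ℝ n b = 0) (x : E3) :
    ∃ r s t : ℝ, x = r • a + s • b + t • n := by
  have hli : LinearIndependent ℝ ![a, b, n] := by
    rw [Fintype.linearIndependent_iff]
    intro g hg
    simp only [Fin.sum_univ_three, Matrix.cons_val_zero, Matrix.cons_val_one,
      Matrix.cons_val] at hg
    have h1 := congrArg (inner ℝ n) hg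
    simp only [inner_add_right, real_inner_smul_right, ha, hb, mul_zero, inner_zero_right,
      zero_add] at h1
    have h2 : g 2 = 0 := by
      rcases mul_eq_zero.1 h1 with h2 | h2
      · exact h2
      · exact absurd (inner_self_eq_zero.1 h2) hn
    rw [h2, zero_smul, add_zero] at hg
    obtain ⟨h3, h4⟩ := h _ _ hg
    intro i
    fin_cases i <;> assumption
  have hspan := hli.span_eq_top_of_card_eq_finrank (by simp)
  have hx : x ∈ Submodule.span ℝ (range ![a, b, n]) := by rw [hspan]; trivial
  rw [Submodule.mem_span_range_iff_exists_fun] at hx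
  obtain ⟨g, hg⟩ := hx
  refine ⟨g 0, g 1, g 2, ?_⟩
  rw [← hg]
  simp [Fin.sum_univ_three]

theorem tangent_independent {f : S2 → E3} {p : S2} (h : Function.Injective (diff f p)) (x y : ℝ)
    (hxy : x • diff f p (tangentBasis 0) + y • diff f p (tangentBasis 1) = 0) :
    x = 0 ∧ y = 0 := by
  rw [tangent_combination] at hxy
  have h1 := (map_eq_zero_iff (diff f p) h).1 hxy
  exact ⟨by simpa using congrArg (fun v => v 0) h1, by simpa using congrArg (fun v => v 1) h1⟩

/-- Differentiate `⟨N, N⟩ = 1`. -/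
theorem inner_diff_self {N : S2 → E3} (hN : ContMDiff (𝓡 2) 𝓘(ℝ, E3) ∞ N)
    (h : ∀ p, ‖N p‖ = 1) (p : S2) (v : EuclideanSpace ℝ (Fin 2)) :
    inner ℝ (N p) (diff N p v) = 0 := by
  rw [diff_eq_fderiv_retract hN]
  set w := diff (fun q : S2 => (q : E3)) p v
  have h1 := (differentiableAt_comp_retract hN p).hasFDerivAt
  have h2 := h1.inner ℝ h1
  have h3 : (fun x => inner ℝ (N (retract x)) (N (retract x))) = fun _ : E3 => (1 : ℝ) := by
    ext x
    rw [real_inner_self_eq_norm_sq, h]; norm_num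
  rw [h3] at h2
  have h4 := congrArg (fun l => l w) (h2.unique (hasFDerivAt_const (1 : ℝ) (p : E3)))
  simp only [ContinuousLinearMap.comp_apply, ContinuousLinearMap.prod_apply,
    fderivInnerCLM_apply, retract_coe, _root_.zero_apply] at h4
  rw [real_inner_comm (N p)] at h4
  linarith

section
variable {F N : ℝ → S2 → E3} {T : ℝ}

theorem IsSmoothFamily.timeDeriv_retract (hF : IsSmoothFamily F (Ico 0 T)) {x : E3} {t : ℝ}
    (hx : x ≠ 0) (ht : t ∈ Ico 0 T) :
    timeDeriv F (Ico 0 T) (x, t) = timeDeriv F (Ico 0 T) (retract x, t) := by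
  have h1 := hF.hasDerivWithinAt_time hx ht
  have h2 := hF.hasDerivWithinAt_time (coe_sphere_ne_zero (retract x)) ht
  rw [retract_coe] at h2
  exact (uniqueDiffOn_Ico 0 T t ht).eq_deriv _ h1 h2

/-- Mixed derivatives in space and time commute up to the initial time. -/
theorem IsSmoothFamily.hasDerivWithinAt_spaceDeriv (hT : 0 < T)
    (hF : IsSmoothFamily F (Ico 0 T)) {x : E3} (hx : x ≠ 0) (e : E3) :
    HasDerivWithinAt (fun t => spaceDeriv F (Ico 0 T) (x, t) e)
      (fderiv ℝ (fun z => timeDeriv F (Ico 0 T) (z, 0)) x e) (Ico 0 T) 0 := by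
  have h0 : (0 : ℝ) ∈ Ico 0 T := ⟨le_rfl, hT⟩
  set S := punctured (Ico 0 T)
  have hS : UniqueDiffOn ℝ S := uniqueDiffOn_punctured (uniqueDiffOn_Ico 0 T)
  have hxS : (x, (0 : ℝ)) ∈ S := ⟨hx, h0⟩
  have hc := hF.contDiffOn
  have hD := ((hc.fderivWithin (m := 1) hS (by norm_cast)) _ hxS).differentiableWithinAt
    (by simp) |>.hasFDerivWithinAt
  set D := fderivWithin ℝ (fderivWithin ℝ (radialExtension F) S) S (x, 0)
  -- The point `(x, 0)` lies on the boundary of the space-time domain; second derivatives are still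
  -- symmetric there because it is in the closure of the interior.
  have hsymm : IsSymmSndFDerivWithinAt ℝ (radialExtension F) S (x, 0) := by
    refine (hc _ hxS).isSymmSndFDerivWithinAt ?_ hS ?_ hxS
    · rw [minSmoothness_of_isRCLikeNormedField]; norm_cast
    · rw [interior_prod_eq, closure_prod_eq, interior_Ico, closure_Ioo hT.ne,
        isOpen_compl_singleton.interior_eq]
      exact ⟨subset_closure hx, left_mem_Icc.2 hT.le⟩
  have h1 : HasDerivWithinAt (fun s : ℝ => (x, s)) ((0 : E3), (1 : ℝ)) (Ico 0 T) 0 :=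
    (hasDerivWithinAt_const 0 _ x).prodMk (hasDerivWithinAt_id 0 _)
  have h2 := hD.comp_hasDerivWithinAt (0 : ℝ) h1 fun s hs => mk_mem_prod hx hs
  have h3 := h2.clm_apply (hasDerivWithinAt_const (0 : ℝ) (Ico 0 T) (e, (0 : ℝ)))
  have h4 : HasFDerivWithinAt (fun z : E3 => (z, (0 : ℝ))) (ContinuousLinearMap.inl ℝ E3 ℝ)
      {0}ᶜ x := (hasFDerivAt_prodMk_left x (0 : ℝ)).hasFDerivWithinAt
  have h5 := (hD.comp x h4 fun z hz => mk_mem_prod hz h0).hasFDerivAt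
    (isOpen_compl_singleton.mem_nhds hx)
  have h6 := h5.clm_apply (hasFDerivAt_const ((0 : E3), (1 : ℝ)) x)
  have h7 : fderiv ℝ (fun z => timeDeriv F (Ico 0 T) (z, 0)) x e = D (e, 0) (0, 1) := by
    have h8 : HasFDerivAt (fun z => timeDeriv F (Ico 0 T) (z, 0)) _ x := h6
    rw [h8.fderiv]
    simp
  rw [h7, hsymm (e, 0) (0, 1)]
  have h9 : HasDerivWithinAt (fun t => spaceDeriv F (Ico 0 T) (x, t) e) _ (Ico 0 T) 0 := h3
  exact h9.congr_deriv (by simp [D])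

variable {η : (S2 → E3) → (S2 → E3) → ℝ} {F₀ : S2 → E3}

/-- The flow equation is assumed only for `t > 0`; both of its sides have limits as `t → 0`, and the
time derivative is continuous up to `t = 0`. -/
theorem IsConstrainedMCF.timeDeriv_zero (h : IsConstrainedMCF η F₀ T F N) (hT : 0 < T) {c : ℝ}
    (hc : Tendsto (fun t => η (F t) (N t)) (𝓝[Ico 0 T] 0) (𝓝 c)) (q : S2) :
    timeDeriv F (Ico 0 T) (q, 0) = (c - meanCurvature (F 0) (N 0) q) • N 0 q := by
  have h0 : (0 : ℝ) ∈ Ico 0 T := ⟨le_rfl, hT⟩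
  have hF : IsSmoothFamily F (Ico 0 T) := h.smooth
  have hN : IsSmoothFamily N (Ico 0 T) := h.smooth_normal
  have hle : 𝓝[Ioo 0 T] (0 : ℝ) ≤ 𝓝[Ico 0 T] 0 := nhdsWithin_mono _ Ioo_subset_Ico_self
  have hne : (𝓝[Ioo 0 T] (0 : ℝ)).NeBot := by
    rw [nhdsWithin_Ioo_eq_nhdsGT hT]; infer_instance
  have hline : ContinuousOn (fun t : ℝ => (q, t)) (Ico 0 T) := by fun_prop
  have h1 : Tendsto (fun t => timeDeriv F (Ico 0 T) (q, t)) (𝓝[Ioo 0 T] 0)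
      (𝓝 (timeDeriv F (Ico 0 T) (q, 0))) := by
    have h2 : ContinuousOn (fun t : ℝ => ((q : E3), t)) (Ico 0 T) := by fun_prop
    exact (((hF.continuousOn_timeDeriv (uniqueDiffOn_Ico 0 T)).comp h2
      fun t ht => mem_punctured q ht) 0 h0).mono_left hle
  have h2 : Tendsto (fun t => meanCurvature (F t) (N t) q) (𝓝[Ioo 0 T] 0)
      (𝓝 (meanCurvature (F 0) (N 0) q)) :=
    (((continuousOn_meanCurvature (uniqueDiffOn_Ico 0 T) hF hN h.immersion
      fun t ht => (h.normal t ht).1).comp hline fun t ht => mk_mem_prod (mem_univ q) ht)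
        0 h0).mono_left hle
  have h3 : Tendsto (fun t => N t q) (𝓝[Ioo 0 T] 0) (𝓝 (N 0 q)) :=
    ((hN.continuousOn.comp hline fun t ht => mk_mem_prod (mem_univ q) ht) 0 h0).mono_left hle
  have h4 : Tendsto (fun t => timeDeriv F (Ico 0 T) (q, t)) (𝓝[Ioo 0 T] 0)
      (𝓝 ((c - meanCurvature (F 0) (N 0) q) • N 0 q)) := by
    refine (((hc.mono_left hle).sub h2).smul h3).congr' ?_
    filter_upwards [self_mem_nhdsWithin] with t ht
    have ht' := Ioo_subset_Ico_self ht
    have h5 := hF.hasDerivWithinAt_time (coe_sphere_ne_zero q) ht'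
    simp only [retract_coe] at h5
    exact (uniqueDiffOn_Ico 0 T t ht').eq_deriv _ (h.flow t ht q).hasDerivWithinAt h5
  exact tendsto_nhds_unique h1 h4

/-- Where the initial velocity is `c N`, the velocity of the tangent vectors is `c dN`. -/
theorem fderiv_timeDeriv_eq {G : S2 → E3} (hF : IsSmoothFamily F (Ico 0 T)) (hT : 0 < T)
    (hG : ContMDiff (𝓡 2) 𝓘(ℝ, E3) ∞ G) {U : Set S2} (hU : IsOpen U) {c : ℝ}
    (h : ∀ q ∈ U, timeDeriv F (Ico 0 T) (q, 0) = c • G q) {p : S2} (hp : p ∈ U)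
    (v : EuclideanSpace ℝ (Fin 2)) :
    fderiv ℝ (fun z => timeDeriv F (Ico 0 T) (z, 0)) p (diff (fun q : S2 => (q : E3)) p v) =
      c • diff G p v := by
  have hp0 := coe_sphere_ne_zero p
  have h1 : (fun z => timeDeriv F (Ico 0 T) (z, 0)) =ᶠ[𝓝 (p : E3)] fun z => c • G (retract z) := by
    have h2 : ContinuousAt retract (p : E3) :=
      (contMDiffOn_retract.contMDiffAt (isOpen_compl_singleton.mem_nhds hp0)).continuousAt
    have h3 : ∀ᶠ z in 𝓝 (p : E3), retract z ∈ U :=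
      h2.eventually_mem (hU.mem_nhds (by rwa [retract_coe]))
    filter_upwards [h3, isOpen_compl_singleton.mem_nhds hp0] with z hz hz0
    rw [hF.timeDeriv_retract hz0 ⟨le_rfl, hT⟩, h _ hz]
  rw [h1.fderiv_eq, fderiv_fun_const_smul (differentiableAt_comp_retract hG p),
    diff_eq_fderiv_retract hG]
  rfl

/-- Where the initial velocity is `c N` with a constant `c`, the normal is stationary. -/
theorem timeDeriv_normal_eq_zero (hF : IsSmoothFamily F (Ico 0 T)) (hN : IsSmoothFamily N (Ico 0 T))
    (hT : 0 < T) (hFt : ∀ t ∈ Ico 0 T, IsSmoothImmersion (F t))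
    (hNt : ∀ t ∈ Ico 0 T, IsUnitNormal (F t) (N t)) {U : Set S2} (hU : IsOpen U) {c : ℝ}
    (h : ∀ q ∈ U, timeDeriv F (Ico 0 T) (q, 0) = c • N 0 q) {p : S2} (hp : p ∈ U) :
    timeDeriv N (Ico 0 T) (p, 0) = 0 := by
  have h0 : (0 : ℝ) ∈ Ico 0 T := ⟨le_rfl, hT⟩
  have hu := uniqueDiffOn_Ico 0 T 0 h0
  have hp0 := coe_sphere_ne_zero p
  have d1 := hN.hasDerivWithinAt_time hp0 h0
  simp only [retract_coe] at d1
  set n' := timeDeriv N (Ico 0 T) (p, 0)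
  have hn1 : inner ℝ (N 0 p) n' = 0 := by
    have h1 := d1.inner ℝ d1
    have h2 := h1.congr (f₁ := fun _ => (1 : ℝ)) (fun t ht => by
      rw [real_inner_self_eq_norm_sq, ((hNt t ht).2 p).1]; norm_num)
      (by rw [real_inner_self_eq_norm_sq, ((hNt 0 h0).2 p).1]; norm_num)
    have h3 := hu.eq_deriv _ h2 (hasDerivWithinAt_const 0 _ 1)
    rw [real_inner_comm (N 0 p)] at h3
    linarith
  -- Differentiating `⟨N, dF eᵢ⟩ = 0` gives `⟨N', dF eᵢ⟩ + c ⟨N, dN eᵢ⟩ = 0`, and the second term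
  -- vanishes because `|N| = 1`. With `hn1`, `N'` is orthogonal to a basis.
  have hn2 : ∀ i, inner ℝ n' (diff (F 0) p (tangentBasis i)) = 0 := by
    intro i
    have d2 := hF.hasDerivWithinAt_spaceDeriv hT hp0 (frame p i)
    rw [frame, fderiv_timeDeriv_eq hF hT (hNt 0 h0).1 hU h hp] at d2
    have h1 := d1.inner ℝ d2
    have h2 := h1.congr (f₁ := fun _ => (0 : ℝ)) (fun t ht => by
      rw [← hF.diff_eq p ht, ((hNt t ht).2 p).2])
      (by rw [← hF.diff_eq p h0, ((hNt 0 h0).2 p).2])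
    have h3 := hu.eq_deriv _ h2 (hasDerivWithinAt_const 0 _ 0)
    rw [← hF.diff_eq p h0, real_inner_smul_right,
      inner_diff_self (hNt 0 h0).1 (fun q => ((hNt 0 h0).2 q).1)] at h3
    linarith
  have hN0 : N 0 p ≠ 0 := fun hz => by simpa [hz] using ((hNt 0 h0).2 p).1
  obtain ⟨r, s, t, hrst⟩ := exists_decomposition (tangent_independent ((hFt 0 h0).2 p)) hN0
    (((hNt 0 h0).2 p).2 _) (((hNt 0 h0).2 p).2 _) n'
  have h4 : inner ℝ n' n' = 0 := by
    have h5 := congrArg (inner ℝ n') hrst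
    rw [inner_add_right, inner_add_right, real_inner_smul_right, real_inner_smul_right,
      real_inner_smul_right, hn2, hn2, real_inner_comm (N 0 p), hn1] at h5
    linarith
  exact inner_self_eq_zero.1 h4

/-- The derivative of the mean curvature of a family of pairs of vectors moving with velocity
`c n₀`, `c n₁`, when the shape operator has eigenvalues `1` and `-1`. -/
theorem hasDerivWithinAt_quotient {A₀ A₁ M₀ M₁ : ℝ → E3} {I : Set ℝ} {c x₀ x₁ y₀ y₁ : ℝ}
    (a₀ : A₀ 0 = !₂[0, x₀, y₀]) (a₁ : A₁ 0 = !₂[0, x₁, y₁])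
    (m₀ : M₀ 0 = !₂[0, x₀, -y₀]) (m₁ : M₁ 0 = !₂[0, x₁, -y₁])
    (dA₀ : HasDerivWithinAt A₀ (c • M₀ 0) I 0) (dA₁ : HasDerivWithinAt A₁ (c • M₁ 0) I 0)
    (dM₀ : HasDerivWithinAt M₀ 0 I 0) (dM₁ : HasDerivWithinAt M₁ 0 I 0)
    (hdet : x₀ * y₁ - x₁ * y₀ ≠ 0) :
    HasDerivWithinAt (fun t =>
      (inner ℝ (A₁ t) (A₁ t) * inner ℝ (M₀ t) (A₀ t) - inner ℝ (A₀ t) (A₁ t) * inner ℝ (M₁ t) (A₀ t)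
        - inner ℝ (A₁ t) (A₀ t) * inner ℝ (M₀ t) (A₁ t)
        + inner ℝ (A₀ t) (A₀ t) * inner ℝ (M₁ t) (A₁ t)) /
      (inner ℝ (A₀ t) (A₀ t) * inner ℝ (A₁ t) (A₁ t) - inner ℝ (A₀ t) (A₁ t) * inner ℝ (A₁ t) (A₀ t)))
      (-2 * c) I 0 := by
  have hd : inner ℝ (A₀ 0) (A₀ 0) * inner ℝ (A₁ 0) (A₁ 0) -
      inner ℝ (A₀ 0) (A₁ 0) * inner ℝ (A₁ 0) (A₀ 0) = (x₀ * y₁ - x₁ * y₀) ^ 2 := by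
    rw [a₀, a₁]
    simp only [PiLp.inner_apply, RCLike.inner_apply, conj_trivial, Fin.sum_univ_three]
    simp
    ring
  have h := (((((dA₁.inner ℝ dA₁).mul (dM₀.inner ℝ dA₀)).sub
    ((dA₀.inner ℝ dA₁).mul (dM₁.inner ℝ dA₀))).sub
    ((dA₁.inner ℝ dA₀).mul (dM₀.inner ℝ dA₁))).add
    ((dA₀.inner ℝ dA₀).mul (dM₁.inner ℝ dA₁))).div
    (((dA₀.inner ℝ dA₀).mul (dA₁.inner ℝ dA₁)).sub ((dA₀.inner ℝ dA₁).mul (dA₁.inner ℝ dA₀)))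
    (by simp only [Pi.sub_apply, Pi.mul_apply]; rw [hd]; exact pow_ne_zero 2 hdet)
  -- In terms of `g` and `h`: `g' = 2c h` and `h'_ij = c ⟨dN eᵢ, dN eⱼ⟩`, so `(tr g⁻¹h)' = -2c|A|² +
  -- c|A|² = -c|A|²`, with `|A|² = 1 + 1` here.
  refine h.congr_deriv ?_
  simp only [Pi.sub_apply, Pi.mul_apply, Pi.add_apply]
  rw [hd, a₀, a₁, m₀, m₁]
  simp only [PiLp.inner_apply, RCLike.inner_apply, conj_trivial, Fin.sum_univ_three,
    PiLp.smul_apply, PiLp.zero_apply, smul_eq_mul, Matrix.cons_val_zero, Matrix.cons_val_one,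
    Matrix.cons_val]
  rw [div_eq_iff (pow_ne_zero 2 (pow_ne_zero 2 hdet))]
  ring

/-- The hypotheses `ha` and `hn` say that the shape operator at `p` fixes the second coordinate
direction and reverses the third. On `U` the velocity is `c N` to first order, so the first
variation of `H` at `p` is `-2c`. -/
theorem IsConstrainedMCF.eventually_meanCurvature_neg (h : IsConstrainedMCF η F₀ T F N)
    (hT : 0 < T) {c : ℝ} (hc0 : 0 < c)
    (hc : Tendsto (fun t => η (F t) (N t)) (𝓝[Ico 0 T] 0) (𝓝 c)) {U : Set S2} (hU : IsOpen U)
    (hH : ∀ q ∈ U, meanCurvature (F 0) (N 0) q = 0) {p : S2} (hp : p ∈ U) {x y : Fin 2 → ℝ}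
    (ha : ∀ i, diff (F 0) p (tangentBasis i) = !₂[0, x i, y i])
    (hn : ∀ i, diff (N 0) p (tangentBasis i) = !₂[0, x i, -y i]) :
    ∀ᶠ t in 𝓝[>] 0, meanCurvature (F t) (N t) p < 0 := by
  have h0 : (0 : ℝ) ∈ Ico 0 T := ⟨le_rfl, hT⟩
  have hF : IsSmoothFamily F (Ico 0 T) := h.smooth
  have hN : IsSmoothFamily N (Ico 0 T) := h.smooth_normal
  have hp0 := coe_sphere_ne_zero p
  have hN0 := (h.normal 0 h0).1
  have hv : ∀ q ∈ U, timeDeriv F (Ico 0 T) (q, 0) = c • N 0 q := fun q hq => by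
    rw [h.timeDeriv_zero hT hc, hH q hq, sub_zero]
  -- Written as `0 • N` so that `fderiv_timeDeriv_eq` also applies to the family `N`, with constant
  -- 0, and shows that `dN` is stationary.
  have hv' : ∀ q ∈ U, timeDeriv N (Ico 0 T) (q, 0) = (0 : ℝ) • N 0 q := fun q hq => by
    rw [timeDeriv_normal_eq_zero hF hN hT h.immersion h.normal hU hv hq, zero_smul]
  have dA : ∀ i, HasDerivWithinAt (fun t => spaceDeriv F (Ico 0 T) (p, t) (frame p i))
      (c • spaceDeriv N (Ico 0 T) (p, 0) (frame p i)) (Ico 0 T) 0 := fun i => by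
    have := hF.hasDerivWithinAt_spaceDeriv hT hp0 (frame p i)
    rwa [frame, fderiv_timeDeriv_eq hF hT hN0 hU hv hp, hN.diff_eq p h0] at this
  have dM : ∀ i, HasDerivWithinAt (fun t => spaceDeriv N (Ico 0 T) (p, t) (frame p i)) 0
      (Ico 0 T) 0 := fun i => by
    have := hN.hasDerivWithinAt_spaceDeriv hT hp0 (frame p i)
    rwa [frame, fderiv_timeDeriv_eq hN hT hN0 hU hv' hp, zero_smul] at this
  have eA : ∀ t ∈ Ico 0 T, ∀ i, diff (F t) p (tangentBasis i) =
      spaceDeriv F (Ico 0 T) (p, t) (frame p i) := fun t ht i => hF.diff_eq p ht _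
  have eM : ∀ t ∈ Ico 0 T, ∀ i, diff (N t) p (tangentBasis i) =
      spaceDeriv N (Ico 0 T) (p, t) (frame p i) := fun t ht i => hN.diff_eq p ht _
  have hdet : x 0 * y 1 - x 1 * y 0 ≠ 0 := by
    have h1 := inducedMetric_det_pos ((h.immersion 0 h0).2 p)
    rw [inducedMetric_det, ha, ha] at h1
    simp only [PiLp.inner_apply, RCLike.inner_apply, conj_trivial, Fin.sum_univ_three] at h1
    simp only [Matrix.cons_val_zero, Matrix.cons_val_one, Matrix.cons_val] at h1
    intro h2
    have h3 : (x 0 * y 1 - x 1 * y 0) ^ 2 = 0 := by rw [h2]; norm_num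
    linarith
  have hd := hasDerivWithinAt_quotient (x₀ := x 0) (x₁ := x 1) (y₀ := y 0) (y₁ := y 1)
    (by rw [← eA 0 h0, ha]) (by rw [← eA 0 h0, ha]) (by rw [← eM 0 h0, hn])
    (by rw [← eM 0 h0, hn]) (dA 0) (dA 1) (dM 0) (dM 1) hdet
  have hd' : HasDerivWithinAt (fun t => meanCurvature (F t) (N t) p) (-2 * c) (Ico 0 T) 0 := by
    have e : ∀ t ∈ Ico 0 T, ∀ X, (_ = X) → meanCurvature (F t) (N t) p = X := fun t ht X hX => by
      rw [meanCurvature_eq, Matrix.det_fin_two]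
      simp only [inducedMetric_apply (hF.diff_eq p ht),
        secondFundamentalForm_apply (hF.diff_eq p ht) (hN.diff_eq p ht)]
      exact hX
    exact hd.congr (fun t ht => e t ht _ rfl) (e 0 h0 _ rfl)
  have hd'' : HasDerivWithinAt (fun t => meanCurvature (F t) (N t) p) (-2 * c) (Ioi 0) 0 := by
    rw [← HasDerivWithinAt.Ioi_iff_Ioo hT]
    exact hd'.mono Ioo_subset_Ico_self
  rw [hasDerivWithinAt_iff_tendsto_slope' (by simp)] at hd''
  filter_upwards [hd''.eventually_lt_const (show -2 * c < 0 by linarith), self_mem_nhdsWithin]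
    with t ht ht0
  rw [slope_def_field, hH p hp, sub_zero, sub_zero] at ht
  rcases div_neg_iff.1 ht with h1 | h1
  · exact absurd h1.2 (not_lt.2 (le_of_lt ht0))
  · exact h1.1

theorem IsConstrainedMCF.exists_iInf_meanCurvature_neg (h : IsConstrainedMCF η F₀ T F N)
    (hT : 0 < T) {c : ℝ} (hc0 : 0 < c)
    (hc : Tendsto (fun t => η (F t) (N t)) (𝓝[Ico 0 T] 0) (𝓝 c)) {U : Set S2} (hU : IsOpen U)
    (hH : ∀ q ∈ U, meanCurvature (F 0) (N 0) q = 0) {p : S2} (hp : p ∈ U) {x y : Fin 2 → ℝ}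
    (ha : ∀ i, diff (F 0) p (tangentBasis i) = !₂[0, x i, y i])
    (hn : ∀ i, diff (N 0) p (tangentBasis i) = !₂[0, x i, -y i]) :
    ∃ ε : ℝ, 0 < ε ∧ ε ≤ T ∧ ∀ t ∈ Ioo 0 ε, (⨅ q : S2, meanCurvature (F t) (N t) q) < (0 : ℝ) := by
  have h1 := h.eventually_meanCurvature_neg hT hc0 hc hU hH hp ha hn
  obtain ⟨u, hu, hsub⟩ := mem_nhdsGT_iff_exists_Ioo_subset.1 h1
  refine ⟨min u T, lt_min hu hT, min_le_right _ _, fun t ht => ?_⟩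
  have htI : t ∈ Ico 0 T := ⟨ht.1.le, ht.2.trans_le (min_le_right _ _)⟩
  -- The real infimum of a family unbounded below is 0 by convention; compactness of the sphere
  -- provides the lower bound.
  have hcont : Continuous fun q => meanCurvature (F t) (N t) q :=
    continuous_slice (continuousOn_meanCurvature (uniqueDiffOn_Ico 0 T) h.smooth h.smooth_normal
      h.immersion fun t ht => (h.normal t ht).1) htI
  exact (ciInf_le (isCompact_range hcont).bddBelow p).trans_lt
    (hsub ⟨ht.1, ht.2.trans_le (min_le_left _ _)⟩)

end

/-! ### The profile curve -/

/-- A smooth function of `w`, flat zero for `w ≤ 1/4`, with value `1` at `w = 1`. -/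
def bend (w : ℝ) : ℝ := expNegInvGlue ((w - 1 / 4) / 2) / expNegInvGlue (3 / 8)

theorem contDiff_bend : ContDiff ℝ ∞ bend :=
  (expNegInvGlue.contDiff.comp ((contDiff_id.sub contDiff_const).div_const _)).div_const _

theorem bend_of_le {w : ℝ} (h : w ≤ 1 / 4) : bend w = 0 := by
  rw [bend, expNegInvGlue.zero_of_nonpos (by linarith), zero_div]

/-- The exponent vanishes at `w = 1`, as `8/3 = 2 / (3/4)`. The coefficient 2 is what makes `bendSq`
concave up to `|s| = 1`; see `deriv_deriv_bendSq_of_gt`. -/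
theorem bend_of_gt {w : ℝ} (h : 1 / 4 < w) : bend w = Real.exp (8 / 3 - 2 / (w - 1 / 4)) := by
  have h1 : ¬ (w - 1 / 4) / 2 ≤ 0 := by linarith
  have h2 : w - 1 / 4 ≠ 0 := by linarith
  rw [bend, expNegInvGlue, expNegInvGlue, if_neg h1, if_neg (by norm_num), ← Real.exp_sub]
  congr 1
  field_simp
  norm_num
  ring

theorem bend_one : bend 1 = 1 := by
  rw [bend_of_gt (by norm_num)]; norm_num

theorem bend_nonneg (w : ℝ) : 0 ≤ bend w :=
  div_nonneg (expNegInvGlue.nonneg _) (expNegInvGlue.nonneg _)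

theorem bend_pos {w : ℝ} (h : 1 / 4 < w) : 0 < bend w := by
  rw [bend_of_gt h]; exact Real.exp_pos _

theorem bend_lt_bend {v w : ℝ} (hv : 1 / 4 < v) (h : v < w) : bend v < bend w := by
  rw [bend_of_gt hv, bend_of_gt (hv.trans h), Real.exp_lt_exp]
  have : 2 / (w - 1 / 4) < 2 / (v - 1 / 4) :=
    div_lt_div_of_pos_left two_pos (by linarith) (by linarith)
  linarith

theorem bend_lt_one {w : ℝ} (h : w < 1) : bend w < 1 := by
  rcases le_or_gt w (1 / 4) with h1 | h1
  · rw [bend_of_le h1]; norm_num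
  · rw [← bend_one]; exact bend_lt_bend h1 h

theorem one_lt_bend {w : ℝ} (h : 1 < w) : 1 < bend w := by
  rw [← bend_one]; exact bend_lt_bend (by norm_num) h

/-- The quotient `(1 - bend w) / (1 - w)`, extended smoothly to `w = 1`. -/
def bendSlope : ℝ → ℝ := dslope bend 1

theorem bendSlope_mul (w : ℝ) : bendSlope w * (1 - w) = 1 - bend w := by
  have h := sub_smul_dslope bend 1 w
  rw [bend_one, smul_eq_mul] at h
  rw [bendSlope]
  linarith

/-- Away from 1 it is a quotient of smooth functions; near 1 `bend` is analytic, and the zero of `1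
- bend` can be divided out of the power series. This is what makes the caps smooth at the poles. -/
theorem contDiff_bendSlope : ContDiff ℝ ∞ bendSlope := by
  rw [contDiff_iff_contDiffAt]
  intro w
  rcases eq_or_ne w 1 with rfl | hw
  · have h1 : AnalyticAt ℝ (fun w : ℝ => Real.exp (8 / 3 - 2 / (w - 1 / 4))) 1 := by
      apply AnalyticAt.rexp
      exact analyticAt_const.sub (analyticAt_const.div (analyticAt_id.sub analyticAt_const)
        (by norm_num))
    have h2 : AnalyticAt ℝ bend 1 := by
      refine h1.congr ?_
      filter_upwards [lt_mem_nhds (show (1 / 4 : ℝ) < 1 by norm_num)] with w hw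
      rw [bend_of_gt hw]
    obtain ⟨s, hs⟩ := h2
    exact AnalyticAt.contDiffAt ⟨_, hs.has_fpower_series_dslope_fslope⟩
  · have h1 : ContDiffAt ℝ ∞ (fun w => (bend w - bend 1) / (w - 1)) w :=
      (contDiff_bend.contDiffAt.sub contDiffAt_const).div (contDiffAt_id.sub contDiffAt_const)
        (sub_ne_zero.2 hw)
    refine h1.congr_of_eventuallyEq ?_
    filter_upwards [dslope_eventuallyEq_slope_of_ne bend hw] with v hv
    rw [bendSlope, hv, slope_def_field]

theorem bendSlope_pos (w : ℝ) : 0 < bendSlope w := by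
  have h := bendSlope_mul w
  rcases lt_trichotomy w 1 with hw | rfl | hw
  · have := bend_lt_one hw
    exact pos_of_mul_pos_left (by rw [h]; linarith) (by linarith)
  -- At `w = 1` the slope is the derivative `2 / (3/4)² = 32/9` of the exponent, the exponential
  -- being 1 there.
  · have h1 : HasDerivAt (fun w : ℝ => Real.exp (8 / 3 - 2 / (w - 1 / 4))) (32 / 9) 1 := by
      have h2 : HasDerivAt (fun w : ℝ => w - 1 / 4) 1 1 := (hasDerivAt_id (1 : ℝ)).sub_const _
      have h3 := (((hasDerivAt_const (1 : ℝ) (2 : ℝ)).div h2 (by norm_num)).const_sub (8 / 3)).exp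
      refine h3.congr_deriv ?_
      norm_num [Pi.div_apply]
    have h2 : deriv bend 1 = 32 / 9 := by
      refine (h1.congr_of_eventuallyEq ?_).deriv
      filter_upwards [lt_mem_nhds (show (1 / 4 : ℝ) < 1 by norm_num)] with w hw
      rw [bend_of_gt hw]
    rw [bendSlope, dslope_same, h2]
    norm_num
  · have := one_lt_bend hw
    nlinarith

/-- The square of the bending factor. -/
def bendSq (s : ℝ) : ℝ := 1 - bend (s ^ 2)

theorem contDiff_bendSq : ContDiff ℝ ∞ bendSq :=
  contDiff_const.sub (contDiff_bend.comp (contDiff_id.pow 2))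

theorem contDiff_deriv_bendSq : ContDiff ℝ ∞ (deriv bendSq) := by
  have := contDiff_bendSq
  rw [show (∞ : ℕ∞ω) = ∞ + 1 from rfl, contDiff_succ_iff_deriv] at this
  exact this.2.2

theorem contDiff_deriv_deriv_bendSq : ContDiff ℝ ∞ (deriv (deriv bendSq)) := by
  have := contDiff_deriv_bendSq
  rw [show (∞ : ℕ∞ω) = ∞ + 1 from rfl, contDiff_succ_iff_deriv] at this
  exact this.2.2

theorem hasDerivAt_bendSq (s : ℝ) : HasDerivAt bendSq (deriv bendSq s) s :=
  (contDiff_bendSq.differentiable (by simp) s).hasDerivAt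

theorem hasDerivAt_deriv_bendSq (s : ℝ) :
    HasDerivAt (deriv bendSq) (deriv (deriv bendSq) s) s :=
  (contDiff_deriv_bendSq.differentiable (by simp) s).hasDerivAt

theorem sq_le_quarter {s : ℝ} : s ^ 2 ≤ 1 / 4 ↔ |s| ≤ 1 / 2 := by
  rw [← sq_abs]
  have := abs_nonneg s
  constructor <;> intro h <;> nlinarith

theorem quarter_lt_sq {s : ℝ} (h : 1 / 2 < |s|) : 1 / 4 < s ^ 2 := by
  by_contra h1
  exact absurd (sq_le_quarter.1 (not_lt.1 h1)) (not_le.2 h)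

theorem bendSq_of_le {s : ℝ} (h : |s| ≤ 1 / 2) : bendSq s = 1 := by
  rw [bendSq, bend_of_le (sq_le_quarter.2 h), sub_zero]

theorem bendSq_pos {s : ℝ} (h : |s| < 1) : 0 < bendSq s := by
  have : s ^ 2 < 1 := (sq_lt_one_iff_abs_lt_one s).2 h
  have := bend_lt_one this
  rw [bendSq]; linarith

theorem bendSq_lt_one {s : ℝ} (h : 1 / 2 < |s|) : bendSq s < 1 := by
  have := bend_pos (quarter_lt_sq h)
  rw [bendSq]; linarith

/-- Serves to carry the vanishing of derivatives from the open neck to its two boundary circles. -/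
theorem eq_zero_of_eq_zero_Ioo {f : ℝ → ℝ} (hf : Continuous f)
    (h : ∀ s ∈ Ioo (-(1 / 2) : ℝ) (1 / 2), f s = 0) {s : ℝ} (hs : |s| ≤ 1 / 2) : f s = 0 := by
  have h1 : IsClosed (f ⁻¹' {0}) := isClosed_singleton.preimage hf
  have h2 : closure (Ioo (-(1 / 2) : ℝ) (1 / 2)) ⊆ f ⁻¹' {0} := closure_minimal h h1
  rw [closure_Ioo (by norm_num)] at h2
  exact h2 (abs_le.1 hs)

theorem deriv_bendSq_Ioo {s : ℝ} (hs : s ∈ Ioo (-(1 / 2) : ℝ) (1 / 2)) : deriv bendSq s = 0 := by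
  have h1 : bendSq =ᶠ[𝓝 s] fun _ => 1 := by
    filter_upwards [isOpen_Ioo.mem_nhds hs] with x hx
    exact bendSq_of_le (abs_le.2 ⟨hx.1.le, hx.2.le⟩)
  rw [h1.deriv_eq, deriv_const]

theorem deriv_bendSq_of_le {s : ℝ} (hs : |s| ≤ 1 / 2) : deriv bendSq s = 0 :=
  eq_zero_of_eq_zero_Ioo contDiff_deriv_bendSq.continuous (fun _ h => deriv_bendSq_Ioo h) hs

theorem deriv_deriv_bendSq_of_le {s : ℝ} (hs : |s| ≤ 1 / 2) : deriv (deriv bendSq) s = 0 := by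
  refine eq_zero_of_eq_zero_Ioo contDiff_deriv_deriv_bendSq.continuous (fun x hx => ?_) hs
  have h1 : deriv bendSq =ᶠ[𝓝 x] fun _ => 0 := by
    filter_upwards [isOpen_Ioo.mem_nhds hx] with y hy
    exact deriv_bendSq_Ioo hy
  rw [h1.deriv_eq, deriv_const]

theorem deriv_bendSq_of_gt {s : ℝ} (hs : 1 / 4 < s ^ 2) :
    deriv bendSq s = -(4 * s * bend (s ^ 2) / (s ^ 2 - 1 / 4) ^ 2) := by
  have hy : s ^ 2 - 1 / 4 ≠ 0 := by linarith
  have h2 : HasDerivAt (fun s : ℝ => s ^ 2 - 1 / 4) (2 * s) s := by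
    simpa using (hasDerivAt_pow 2 s).sub_const (1 / 4)
  have h3 := ((((hasDerivAt_const s (2 : ℝ)).div h2 hy).const_sub (8 / 3)).exp).const_sub 1
  have h4 : bendSq =ᶠ[𝓝 s] fun s => 1 - Real.exp (8 / 3 - 2 / (s ^ 2 - 1 / 4)) := by
    have : ∀ᶠ x in 𝓝 s, 1 / 4 < x ^ 2 := (continuous_pow 2).continuousAt.eventually_const_lt hs
    filter_upwards [this] with x hx
    rw [bendSq, bend_of_gt hx]
  rw [h4.deriv_eq, bend_of_gt hs]
  refine h3.deriv.trans ?_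
  simp only [Pi.div_apply]
  ring

/-- Put `y = s² - 1/4`. With `k / y` in the exponent of `bend`, the critical term of `(bend (s²))''`
would carry the factor `k - 2y`. For `k = 2` it is positive on the caps, where `y ≤ 3/4`; for `k =
1` concavity fails at the poles. -/
theorem deriv_deriv_bendSq_of_gt {s : ℝ} (hs : 1 / 4 < s ^ 2) :
    deriv (deriv bendSq) s = -(bend (s ^ 2) *
      (16 * s ^ 2 * (1 - (s ^ 2 - 1 / 4)) + 4 * (s ^ 2 - 1 / 4) ^ 2) / (s ^ 2 - 1 / 4) ^ 4) := by
  have hy : s ^ 2 - 1 / 4 ≠ 0 := by linarith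
  have h2 : HasDerivAt (fun s : ℝ => s ^ 2 - 1 / 4) (2 * s) s := by
    simpa using (hasDerivAt_pow 2 s).sub_const (1 / 4)
  have h5 : HasDerivAt (fun s => bend (s ^ 2)) (4 * s * bend (s ^ 2) / (s ^ 2 - 1 / 4) ^ 2) s := by
    have := (hasDerivAt_bendSq s).const_sub 1
    rw [deriv_bendSq_of_gt hs, neg_neg] at this
    refine this.congr_of_eventuallyEq (Eventually.of_forall fun x => ?_)
    simp [bendSq]
  have h6 := ((((hasDerivAt_id s).const_mul 4).mul h5).div (h2.pow 2) (pow_ne_zero 2 hy)).neg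
  have h4 : deriv bendSq =ᶠ[𝓝 s] fun s => -(4 * s * bend (s ^ 2) / (s ^ 2 - 1 / 4) ^ 2) := by
    have : ∀ᶠ x in 𝓝 s, 1 / 4 < x ^ 2 := (continuous_pow 2).continuousAt.eventually_const_lt hs
    filter_upwards [this] with x hx
    exact deriv_bendSq_of_gt hx
  rw [h4.deriv_eq]
  refine h6.deriv.trans ?_
  simp only [Pi.mul_apply, Pi.pow_apply, id]
  generalize s ^ 2 - 1 / 4 = y at hy
  field_simp
  ring

theorem deriv_bendSq_ne_zero {s : ℝ} (h : 1 / 2 < |s|) : deriv bendSq s ≠ 0 := by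
  have h1 := quarter_lt_sq h
  have h2 : s ≠ 0 := by rintro rfl; norm_num at h
  have h3 : s ^ 2 - 1 / 4 ≠ 0 := by linarith
  rw [deriv_bendSq_of_gt h1]
  exact neg_ne_zero.2 (div_ne_zero (mul_ne_zero (mul_ne_zero (by norm_num) h2) (bend_pos h1).ne')
    (pow_ne_zero 2 h3))

theorem deriv_bendSq_neg {s : ℝ} (h : 1 / 2 < s) : deriv bendSq s < 0 := by
  have h1 := quarter_lt_sq (h.trans_le (le_abs_self s))
  have h3 : 0 < s ^ 2 - 1 / 4 := by linarith
  rw [deriv_bendSq_of_gt h1]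
  have := bend_pos h1
  have h4 : 0 < s := by linarith
  exact neg_neg_of_pos (by positivity)

theorem deriv_deriv_bendSq_nonpos {s : ℝ} (h : |s| ≤ 1) : deriv (deriv bendSq) s ≤ 0 := by
  rcases le_or_gt |s| (1 / 2) with h1 | h1
  · exact (deriv_deriv_bendSq_of_le h1).le
  · have h2 := quarter_lt_sq h1
    rw [deriv_deriv_bendSq_of_gt h2]
    have h3 : 0 < s ^ 2 - 1 / 4 := by linarith
    have h4 : s ^ 2 ≤ 1 := (sq_le_one_iff_abs_le_one s).2 h
    have h5 := bend_pos h2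
    have h6 : 0 ≤ 1 - (s ^ 2 - 1 / 4) := by linarith
    exact neg_nonpos.2 (by positivity)

theorem strictAntiOn_bendSq : StrictAntiOn bendSq (Icc (1 / 2) 1) := by
  refine strictAntiOn_of_deriv_neg (convex_Icc _ _) contDiff_bendSq.continuous.continuousOn ?_
  intro s hs
  rw [interior_Icc] at hs
  exact deriv_bendSq_neg hs.1

theorem concaveOn_bendSq : ConcaveOn ℝ (Icc (1 / 2) 1) bendSq := by
  refine concaveOn_of_deriv2_nonpos (convex_Icc _ _) contDiff_bendSq.continuous.continuousOn
    (contDiff_bendSq.differentiable (by simp)).differentiableOn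
    (contDiff_deriv_bendSq.differentiable (by simp)).differentiableOn ?_
  intro s hs
  rw [interior_Icc] at hs
  exact deriv_deriv_bendSq_nonpos (abs_le.2 ⟨by linarith [hs.1], hs.2.le⟩)

theorem bendSq_one : bendSq 1 = 0 := by simp [bendSq, bend_one]

theorem bendSq_nonneg {s : ℝ} (h : |s| ≤ 1) : 0 ≤ bendSq s := by
  rcases h.lt_or_eq with h | h
  · exact (bendSq_pos h).le
  · rw [bendSq, ← sq_abs, h, one_pow, bend_one, sub_self]

/-- The bending factor of the caps. -/
def bendFactor (s : ℝ) : ℝ := √(bendSq s)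

theorem strictAntiOn_bendFactor : StrictAntiOn bendFactor (Icc (1 / 2) 1) := by
  intro x hx y hy hxy
  refine Real.sqrt_lt_sqrt (bendSq_nonneg ?_) (strictAntiOn_bendSq hx hy hxy)
  exact abs_le.2 ⟨by linarith [hy.1], hy.2⟩

/-- The square root is concave and increasing, so it preserves concavity of `bendSq`. -/
theorem concaveOn_bendFactor : ConcaveOn ℝ (Icc (1 / 2) 1) bendFactor := by
  have h1 : MapsTo bendSq (Icc (1 / 2) 1) (Ici 0) := fun s hs =>
    bendSq_nonneg (abs_le.2 ⟨by linarith [hs.1], hs.2⟩)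
  refine ⟨convex_Icc _ _, fun x hx y hy a b ha hb hab => ?_⟩
  have h2 := Real.strictConcaveOn_sqrt.concaveOn.2 (h1 hx) (h1 hy) ha hb hab
  exact h2.trans (Real.sqrt_le_sqrt (concaveOn_bendSq.2 hx hy ha hb hab))

/-! ### The squared radius and its derivatives -/

/-- The squared radius of the surface of revolution at height `s`. -/
def radiusSq (s : ℝ) : ℝ := Real.cosh s ^ 2 * bendSq s

/-- The derivative of `radiusSq`. -/
def radiusSq' (s : ℝ) : ℝ :=
  2 * Real.cosh s * Real.sinh s * bendSq s + Real.cosh s ^ 2 * deriv bendSq s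

/-- The second derivative of `radiusSq`. -/
def radiusSq'' (s : ℝ) : ℝ :=
  2 * (Real.sinh s ^ 2 + Real.cosh s ^ 2) * bendSq s +
    4 * Real.cosh s * Real.sinh s * deriv bendSq s + Real.cosh s ^ 2 * deriv (deriv bendSq) s

theorem hasDerivAt_radiusSq (s : ℝ) : HasDerivAt radiusSq (radiusSq' s) s := by
  have h := ((Real.hasDerivAt_cosh s).pow 2).mul (hasDerivAt_bendSq s)
  refine h.congr_deriv ?_
  simp only [Pi.pow_apply, radiusSq']
  ring

theorem hasDerivAt_radiusSq' (s : ℝ) : HasDerivAt radiusSq' (radiusSq'' s) s := by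
  have h := ((((Real.hasDerivAt_cosh s).const_mul 2).mul (Real.hasDerivAt_sinh s)).mul
    (hasDerivAt_bendSq s)).add (((Real.hasDerivAt_cosh s).pow 2).mul (hasDerivAt_deriv_bendSq s))
  refine h.congr_deriv ?_
  simp only [Pi.pow_apply, Pi.mul_apply, radiusSq'']
  ring

theorem contDiff_radiusSq : ContDiff ℝ ∞ radiusSq :=
  (Real.contDiff_cosh.pow 2).mul contDiff_bendSq

theorem contDiff_radiusSq' : ContDiff ℝ ∞ radiusSq' :=
  (((contDiff_const.mul Real.contDiff_cosh).mul Real.contDiff_sinh).mul contDiff_bendSq).add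
    ((Real.contDiff_cosh.pow 2).mul contDiff_deriv_bendSq)

/-- The square of the norm of the gradient of `(x₁² + x₂² - radiusSq x₃) / 2` on the surface. -/
def gradSq (s : ℝ) : ℝ := radiusSq s + radiusSq' s ^ 2 / 4

theorem gradSq_pos {s : ℝ} (h : |s| ≤ 1) : 0 < gradSq s := by
  have hc := Real.cosh_pos s
  rcases h.lt_or_eq with h | h
  · have := bendSq_pos h
    rw [gradSq, radiusSq]
    positivity
  -- At the poles the radius vanishes, but the zero of `bendSq` is simple, so the gradient is
  -- vertical and nonzero.
  · have h1 : bendSq s = 0 := by rw [bendSq, ← sq_abs, h, one_pow, bend_one, sub_self]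
    have h2 := deriv_bendSq_ne_zero (show 1 / 2 < |s| by rw [h]; norm_num)
    have h3 : gradSq s = (Real.cosh s ^ 2 * deriv bendSq s) ^ 2 / 4 := by
      rw [gradSq, radiusSq, radiusSq', h1]; ring
    rw [h3]
    positivity

/-- The numerator of the mean curvature. -/
def curvatureNum (s : ℝ) : ℝ := radiusSq s + radiusSq' s ^ 2 / 2 - radiusSq s * radiusSq'' s / 2

/-- Since `cosh² = 1 + sinh²`, the catenoid part cancels and only terms measuring the deviation of
`bendSq` from 1 remain. Each has a sign once `0 ≤ bendSq ≤ 1` and `bendSq'' ≤ 0`. -/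
theorem curvatureNum_eq (s : ℝ) : curvatureNum s =
    Real.cosh s ^ 2 * bendSq s * (1 - bendSq s) +
      Real.cosh s ^ 4 / 2 * (deriv bendSq s ^ 2 - bendSq s * deriv (deriv bendSq) s) := by
  rw [curvatureNum, radiusSq, radiusSq', radiusSq'']
  linear_combination (-Real.cosh s ^ 2 * bendSq s ^ 2) * (Real.cosh_sq s)

theorem curvatureNum_of_le {s : ℝ} (h : |s| ≤ 1 / 2) : curvatureNum s = 0 := by
  rw [curvatureNum_eq, bendSq_of_le h, deriv_bendSq_of_le h, deriv_deriv_bendSq_of_le h]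
  ring

theorem curvatureNum_pos {s : ℝ} (h : 1 / 2 < |s|) (h1 : |s| ≤ 1) : 0 < curvatureNum s := by
  have hc := Real.cosh_pos s
  have h2 := deriv_bendSq_ne_zero h
  have h3 := bendSq_nonneg h1
  have h4 : 0 ≤ 1 - bendSq s := by linarith [bendSq_lt_one h]
  have h5 : 0 ≤ -(bendSq s * deriv (deriv bendSq) s) := by
    have := deriv_deriv_bendSq_nonpos h1
    nlinarith
  have h6 : 0 < deriv bendSq s ^ 2 := by positivity
  have h7 : 0 < deriv bendSq s ^ 2 - bendSq s * deriv (deriv bendSq) s := by linarith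
  rw [curvatureNum_eq]
  positivity

/-- The horizontal stretching factor of the embedding. -/
def stretch (s : ℝ) : ℝ := Real.cosh s * √(bendSlope (s ^ 2))

theorem stretch_pos (s : ℝ) : 0 < stretch s :=
  mul_pos (Real.cosh_pos s) (Real.sqrt_pos.2 (bendSlope_pos _))

theorem contDiff_stretch : ContDiff ℝ ∞ stretch :=
  Real.contDiff_cosh.mul ((contDiff_bendSlope.comp (contDiff_id.pow 2)).sqrt
    fun _ => (bendSlope_pos _).ne')

/-- On the unit sphere `x₁² + x₂² = 1 - s²` at height `s`, so this sends the latitude circle to the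
circle of squared radius `radiusSq s`. -/
theorem stretch_sq (s : ℝ) : stretch s ^ 2 * (1 - s ^ 2) = radiusSq s := by
  rw [stretch, mul_pow, Real.sq_sqrt (bendSlope_pos _).le, mul_assoc, bendSlope_mul, radiusSq,
    bendSq]

theorem stretch_zero : stretch 0 = 1 := by
  have h := stretch_sq 0
  rw [radiusSq, bendSq_of_le (by norm_num), Real.cosh_zero] at h
  have h1 : stretch 0 ^ 2 = 1 := by linarith
  have := stretch_pos 0
  nlinarith

theorem hasDerivAt_stretch (s : ℝ) : HasDerivAt stretch (deriv stretch s) s :=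
  (contDiff_stretch.differentiable (by simp) s).hasDerivAt

theorem radiusSq'_eq (s : ℝ) : radiusSq' s =
    2 * stretch s * deriv stretch s * (1 - s ^ 2) - 2 * s * stretch s ^ 2 := by
  have h1 := ((hasDerivAt_stretch s).pow 2).mul ((hasDerivAt_pow 2 s).const_sub 1)
  have h2 : HasDerivAt radiusSq _ s :=
    h1.congr_of_eventuallyEq (.of_eq (funext stretch_sq).symm)
  rw [(hasDerivAt_radiusSq s).unique h2]
  simp only [Pi.pow_apply]
  norm_num
  ring

/-- `stretch` is even. -/
theorem deriv_stretch_zero : deriv stretch 0 = 0 := by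
  have h1 : stretch = fun s => stretch (-s) := by
    funext; simp [stretch, Real.cosh_neg]
  have h2 := deriv_comp_neg (f := stretch) (0 : ℝ)
  rw [← h1, neg_zero] at h2
  linarith

/-! ### The embedded sphere of revolution -/

theorem sphere_sum_sq (p : S2) : (p : E3) 0 ^ 2 + (p : E3) 1 ^ 2 + (p : E3) 2 ^ 2 = 1 := by
  have h := EuclideanSpace.norm_sq_eq (p : E3)
  rw [norm_coe_sphere, Fin.sum_univ_three] at h
  simp only [Real.norm_eq_abs, sq_abs] at h
  linarith

theorem abs_sphere_le (p : S2) : |(p : E3) 2| ≤ 1 := by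
  rw [← sq_le_one_iff_abs_le_one]
  nlinarith [sphere_sum_sq p, sq_nonneg ((p : E3) 0), sq_nonneg ((p : E3) 1)]

/-- The embedding of the sphere, extended to `ℝ³`. -/
def surfaceExt (x : E3) : E3 := !₂[stretch (x 2) * x 0, stretch (x 2) * x 1, x 2]

/-- The outer normal vector with squared norm `gradSq`, extended to `ℝ³`. -/
def normalExt (x : E3) : E3 :=
  !₂[stretch (x 2) * x 0, stretch (x 2) * x 1, -(radiusSq' (x 2) / 2)]

/-- The unit normal field, extended to `ℝ³`. -/
def unitNormalExt (x : E3) : E3 := (√(gradSq (x 2)))⁻¹ • normalExt x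

/-- The embedding of the sphere as a bent catenoid. -/
def bentSurface (p : S2) : E3 := surfaceExt p

/-- The outward unit normal field of `bentSurface`. -/
def bentNormal (p : S2) : E3 := unitNormalExt p

theorem contDiff_coord (i : Fin 3) : ContDiff ℝ ∞ fun x : E3 => x i :=
  (EuclideanSpace.proj i : E3 →L[ℝ] ℝ).contDiff

theorem contDiff_surfaceExt : ContDiff ℝ ∞ surfaceExt := by
  have h := contDiff_stretch.comp (contDiff_coord 2)
  rw [contDiff_euclidean]
  intro i
  fin_cases i
  · exact h.mul (contDiff_coord 0)
  · exact h.mul (contDiff_coord 1)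
  · exact contDiff_coord 2

theorem contDiff_normalExt : ContDiff ℝ ∞ normalExt := by
  have h := contDiff_stretch.comp (contDiff_coord 2)
  rw [contDiff_euclidean]
  intro i
  fin_cases i
  · exact h.mul (contDiff_coord 0)
  · exact h.mul (contDiff_coord 1)
  · exact ((contDiff_radiusSq'.comp (contDiff_coord 2)).div_const 2).neg

theorem contDiffAt_inv_sqrt_gradSq (p : S2) :
    ContDiffAt ℝ ∞ (fun x : E3 => (√(gradSq (x 2)))⁻¹) (p : E3) := by
  have h := gradSq_pos (abs_sphere_le p)
  have h1 : ContDiff ℝ ∞ gradSq := contDiff_radiusSq.add ((contDiff_radiusSq'.pow 2).div_const 4)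
  exact (((h1.comp (contDiff_coord 2)).contDiffAt).sqrt h.ne').inv (Real.sqrt_pos.2 h).ne'

theorem contDiffAt_unitNormalExt (p : S2) : ContDiffAt ℝ ∞ unitNormalExt (p : E3) :=
  (contDiffAt_inv_sqrt_gradSq p).smul contDiff_normalExt.contDiffAt

theorem contMDiff_bentSurface : ContMDiff (𝓡 2) 𝓘(ℝ, E3) ∞ bentSurface :=
  contDiff_surfaceExt.contMDiff.comp contMDiff_coe

theorem contMDiff_bentNormal : ContMDiff (𝓡 2) 𝓘(ℝ, E3) ∞ bentNormal := fun p =>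
  (contDiffAt_unitNormalExt p).contMDiffAt.comp p (contMDiff_coe p)

theorem hasFDerivAt_coord (i : Fin 3) (x : E3) :
    HasFDerivAt (fun x : E3 => x i) (EuclideanSpace.proj i : E3 →L[ℝ] ℝ) x :=
  (EuclideanSpace.proj i : E3 →L[ℝ] ℝ).hasFDerivAt

theorem fderiv_apply_coord {f : E3 → E3} {x : E3} (hf : DifferentiableAt ℝ f x) (i : Fin 3)
    {l : E3 →L[ℝ] ℝ} (hl : HasFDerivAt (fun x => f x i) l x) (w : E3) :
    fderiv ℝ f x w i = l w := by
  have h : HasFDerivAt (fun x => f x i) _ x :=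
    (hasFDerivAt_coord i (f x)).comp x hf.hasFDerivAt
  rw [hl.unique h]
  rfl

theorem hasFDerivAt_stretch_mul (i : Fin 3) (x : E3) :
    HasFDerivAt (fun x : E3 => stretch (x 2) * x i)
      (stretch (x 2) • (EuclideanSpace.proj i : E3 →L[ℝ] ℝ) +
        x i • deriv stretch (x 2) • (EuclideanSpace.proj 2 : E3 →L[ℝ] ℝ)) x :=
  (HasDerivAt.comp_hasFDerivAt (h₂ := stretch) x (hasDerivAt_stretch (x 2))
    (hasFDerivAt_coord 2 x)).mul (hasFDerivAt_coord i x)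

theorem fderiv_surfaceExt (x w : E3) : fderiv ℝ surfaceExt x w =
    !₂[stretch (x 2) * w 0 + deriv stretch (x 2) * x 0 * w 2,
      stretch (x 2) * w 1 + deriv stretch (x 2) * x 1 * w 2, w 2] := by
  have hd := contDiff_surfaceExt.differentiable (by simp) x
  ext i
  fin_cases i
  · refine (fderiv_apply_coord hd 0 (hasFDerivAt_stretch_mul 0 x) w).trans ?_
    simp
    ring
  · refine (fderiv_apply_coord hd 1 (hasFDerivAt_stretch_mul 1 x) w).trans ?_
    simp
    ring
  · exact fderiv_apply_coord hd 2 (hasFDerivAt_coord 2 x) w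

theorem fderiv_normalExt (x w : E3) : fderiv ℝ normalExt x w =
    !₂[stretch (x 2) * w 0 + deriv stretch (x 2) * x 0 * w 2,
      stretch (x 2) * w 1 + deriv stretch (x 2) * x 1 * w 2, -(radiusSq'' (x 2) / 2 * w 2)] := by
  have hd := contDiff_normalExt.differentiable (by simp) x
  ext i
  fin_cases i
  · refine (fderiv_apply_coord hd 0 (hasFDerivAt_stretch_mul 0 x) w).trans ?_
    simp
    ring
  · refine (fderiv_apply_coord hd 1 (hasFDerivAt_stretch_mul 1 x) w).trans ?_
    simp
    ring
  · have h : HasFDerivAt (fun x : E3 => -(radiusSq' (x 2) / 2)) _ x :=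
      HasDerivAt.comp_hasFDerivAt (h₂ := fun s => -(radiusSq' s / 2)) x
        ((hasDerivAt_radiusSq' (x 2)).div_const 2).neg (hasFDerivAt_coord 2 x)
    refine (fderiv_apply_coord hd 2 h w).trans ?_
    simp

theorem diff_bentSurface (p : S2) (v : EuclideanSpace ℝ (Fin 2)) :
    diff bentSurface p v = fderiv ℝ surfaceExt p (diff (fun q : S2 => (q : E3)) p v) :=
  diff_comp_coe (contDiff_surfaceExt.differentiable (by simp) _).hasFDerivAt (fun _ => rfl) v

theorem diff_bentNormal (p : S2) (v : EuclideanSpace ℝ (Fin 2)) :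
    diff bentNormal p v = fderiv ℝ unitNormalExt p (diff (fun q : S2 => (q : E3)) p v) :=
  diff_comp_coe ((contDiffAt_unitNormalExt p).differentiableAt (by simp)).hasFDerivAt
    (fun _ => rfl) v

/-- Differentiating the normalizing factor only adds a multiple of the normal. It drops out against
tangent vectors, so `l` need not be known. -/
theorem fderiv_unitNormalExt (p : S2) : ∃ l : E3 → ℝ, ∀ w : E3, fderiv ℝ unitNormalExt p w =
    (√(gradSq ((p : E3) 2)))⁻¹ • fderiv ℝ normalExt p w + l w • normalExt p := by
  have h1 := ((contDiffAt_inv_sqrt_gradSq p).differentiableAt (by simp)).hasFDerivAt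
  have h2 := (contDiff_normalExt.differentiable (by simp) (p : E3)).hasFDerivAt
  have h3 : HasFDerivAt unitNormalExt _ (p : E3) := h1.smul h2
  refine ⟨fderiv ℝ (fun x : E3 => (√(gradSq (x 2)))⁻¹) p, fun w => ?_⟩
  rw [h3.fderiv]
  simp only [_root_.add_apply, _root_.smul_apply,
    ContinuousLinearMap.smulRight_apply]

theorem inner_three (x y : E3) : inner ℝ x y = x 0 * y 0 + x 1 * y 1 + x 2 * y 2 := by
  simp only [PiLp.inner_apply, RCLike.inner_apply, conj_trivial, Fin.sum_univ_three]
  ring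

theorem injective_diff_bentSurface (p : S2) : Function.Injective (diff bentSurface p) := by
  rw [injective_iff_map_eq_zero]
  intro v hv
  rw [diff_bentSurface, fderiv_surfaceExt] at hv
  refine (map_eq_zero_iff _ (injective_diff_coe p)).1 ?_
  set w := diff (fun q : S2 => (q : E3)) p v
  have h0 := congrArg (fun x : E3 => x 0) hv
  have h1 := congrArg (fun x : E3 => x 1) hv
  have h2 := congrArg (fun x : E3 => x 2) hv
  simp at h0 h1 h2
  have hs := (stretch_pos ((p : E3) 2)).ne'
  rw [h2] at h0 h1
  simp [hs] at h0 h1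
  ext i
  fin_cases i <;> simpa

theorem isSmoothImmersion_bentSurface : IsSmoothImmersion bentSurface :=
  ⟨contMDiff_bentSurface, injective_diff_bentSurface⟩

theorem isSmoothEmbedding_bentSurface : IsSmoothEmbedding bentSurface := by
  refine ⟨isSmoothImmersion_bentSurface,
    (contMDiff_bentSurface.continuous.isClosedEmbedding ?_).isEmbedding⟩
  intro p q hpq
  have h0 := congrArg (fun x : E3 => x 0) hpq
  have h1 := congrArg (fun x : E3 => x 1) hpq
  have h2 := congrArg (fun x : E3 => x 2) hpq
  simp only [bentSurface, surfaceExt, Matrix.cons_val_zero, Matrix.cons_val_one,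
    Matrix.cons_val] at h0 h1 h2
  have hs := (stretch_pos ((q : E3) 2)).ne'
  rw [h2] at h0 h1
  ext i
  fin_cases i
  · exact mul_left_cancel₀ hs h0
  · exact mul_left_cancel₀ hs h1
  · exact h2

theorem inner_normalExt_self (p : S2) :
    inner ℝ (normalExt p) (normalExt p) = gradSq ((p : E3) 2) := by
  rw [inner_three, gradSq, ← stretch_sq]
  simp only [normalExt, Matrix.cons_val_zero, Matrix.cons_val_one, Matrix.cons_val]
  linear_combination (stretch ((p : E3) 2)) ^ 2 * sphere_sum_sq p

theorem inner_normalExt_diff (p : S2) (v : EuclideanSpace ℝ (Fin 2)) :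
    inner ℝ (normalExt p) (diff bentSurface p v) = 0 := by
  rw [diff_bentSurface, fderiv_surfaceExt, inner_three]
  have h1 := inner_diff_coe p v
  set w := diff (fun q : S2 => (q : E3)) p v
  rw [inner_three] at h1
  simp only [normalExt, Matrix.cons_val_zero, Matrix.cons_val_one, Matrix.cons_val]
  rw [radiusSq'_eq]
  linear_combination (stretch ((p : E3) 2)) ^ 2 * h1 +
    stretch ((p : E3) 2) * deriv stretch ((p : E3) 2) * w 2 * sphere_sum_sq p

theorem isUnitNormal_bentNormal : IsUnitNormal bentSurface bentNormal := by
  refine ⟨contMDiff_bentNormal, fun p => ⟨?_, fun v => ?_⟩⟩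
  · have h := Real.sqrt_pos.2 (gradSq_pos (abs_sphere_le p))
    have h1 : ‖normalExt p‖ = √(gradSq ((p : E3) 2)) := by
      rw [← inner_normalExt_self, real_inner_self_eq_norm_sq, Real.sqrt_sq (norm_nonneg _)]
    rw [bentNormal, unitNormalExt, norm_smul, h1, norm_inv, Real.norm_of_nonneg h.le,
      inv_mul_cancel₀ h.ne']
  · rw [bentNormal, unitNormalExt, real_inner_smul_left, inner_normalExt_diff, mul_zero]

/-- The squared length of the tangential part of a vector. -/
theorem tangential_norm_sq {a b n : E3} (h : ∀ x y : ℝ, x • a + y • b = 0 → x = 0 ∧ y = 0)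
    (hn : inner ℝ n n = 1) (ha : inner ℝ n a = 0) (hb : inner ℝ n b = 0) (e : E3) :
    inner ℝ b b * inner ℝ a e ^ 2 - 2 * inner ℝ a b * inner ℝ a e * inner ℝ b e +
      inner ℝ a a * inner ℝ b e ^ 2 =
    (inner ℝ a a * inner ℝ b b - inner ℝ a b * inner ℝ a b) *
      (inner ℝ e e - inner ℝ n e ^ 2) := by
  have hn0 : n ≠ 0 := by rintro rfl; simp at hn
  obtain ⟨r, s, t, rfl⟩ := exists_decomposition h hn0 ha hb e
  have ha' : inner ℝ a n = 0 := by rw [real_inner_comm]; exact ha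
  have hb' : inner ℝ b n = 0 := by rw [real_inner_comm]; exact hb
  have hab : inner ℝ b a = inner ℝ a b := real_inner_comm a b
  simp only [inner_add_left, inner_add_right, real_inner_smul_left, real_inner_smul_right, ha, hb,
    ha', hb', hn, hab]
  ring

/-- Write `R` for `radiusSq`, `D = gradSq`, and `uᵢ` for the third component of `df eᵢ`. Then `h_ij
= D^(-1/2) (g_ij - (1 + R''/2) uᵢ uⱼ)`. Its trace is `D^(-1/2) (2 - (1 + R''/2) |e₃ᵀ|²)`, where the
tangential part of `e₃` has `|e₃ᵀ|² = 1 - R'²/(4D) = R/D`. -/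
theorem meanCurvature_bentSurface (p : S2) : meanCurvature bentSurface bentNormal p =
    curvatureNum ((p : E3) 2) / (gradSq ((p : E3) 2) * √(gradSq ((p : E3) 2))) := by
  obtain ⟨l, hl⟩ := fderiv_unitNormalExt p
  have hD := gradSq_pos (abs_sphere_le p)
  have hD' := Real.sqrt_pos.2 hD
  have hdet := inducedMetric_det_pos (injective_diff_bentSurface p)
  have hdet' := inducedMetric_det bentSurface p
  set e : E3 := EuclideanSpace.single 2 1 with he
  have hie : ∀ x : E3, inner ℝ x e = x 2 := fun x => by simp [he, inner_three]
  have hpart := tangential_norm_sq (tangent_independent (injective_diff_bentSurface p))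
    (by rw [real_inner_self_eq_norm_sq, (isUnitNormal_bentNormal.2 p).1]; norm_num)
    ((isUnitNormal_bentNormal.2 p).2 _) ((isUnitNormal_bentNormal.2 p).2 _) e
  simp only [hie] at hpart
  rw [← hdet'] at hpart
  have he2 : e 2 = 1 := by simp [he]
  have hn2 : bentNormal p 2 ^ 2 = radiusSq' ((p : E3) 2) ^ 2 / (4 * gradSq ((p : E3) 2)) := by
    simp only [bentNormal, unitNormalExt, normalExt, PiLp.smul_apply, smul_eq_mul, Matrix.cons_val]
    rw [mul_pow, inv_pow, Real.sq_sqrt hD.le]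
    field_simp
    ring
  have hsff : ∀ i j, secondFundamentalForm bentSurface bentNormal p i j =
      (√(gradSq ((p : E3) 2)))⁻¹ * (inducedMetric bentSurface p i j -
        (1 + radiusSq'' ((p : E3) 2) / 2) * (diff bentSurface p (tangentBasis i) 2) *
          (diff bentSurface p (tangentBasis j) 2)) := fun i j => by
    simp only [secondFundamentalForm, inducedMetric, Matrix.of_apply]
    rw [diff_bentNormal, hl, inner_add_left, real_inner_smul_left, real_inner_smul_left,
      inner_normalExt_diff, mul_zero, add_zero]
    congr 1
    rw [diff_bentSurface, diff_bentSurface, fderiv_normalExt, fderiv_surfaceExt, fderiv_surfaceExt,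
      inner_three, inner_three]
    simp only [Matrix.cons_val_zero, Matrix.cons_val_one, Matrix.cons_val]
    ring
  have hsymm : inducedMetric bentSurface p 1 0 = inducedMetric bentSurface p 0 1 := by
    simp only [inducedMetric, Matrix.of_apply]
    exact real_inner_comm _ _
  have hdet2 := Matrix.det_fin_two (inducedMetric bentSurface p)
  rw [hsymm] at hdet2
  rw [meanCurvature_eq, hsff, hsff, hsff, hsff, hsymm, div_eq_div_iff hdet.ne'
    (mul_pos hD hD').ne']
  change inducedMetric bentSurface p 1 1 * _ ^ 2 - 2 * inducedMetric bentSurface p 0 1 * _ * _ +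
    inducedMetric bentSurface p 0 0 * _ ^ 2 = _ at hpart
  rw [hn2, he2] at hpart
  have hg : gradSq ((p : E3) 2) = radiusSq ((p : E3) 2) + radiusSq' ((p : E3) 2) ^ 2 / 4 := rfl
  rw [curvatureNum]
  generalize inducedMetric bentSurface p = g at *
  generalize diff bentSurface p (tangentBasis 0) 2 = u at *
  generalize diff bentSurface p (tangentBasis 1) 2 = v at *
  generalize radiusSq'' ((p : E3) 2) = R2 at *
  have hpart' : (g 1 1 * u ^ 2 - 2 * g 0 1 * u * v + g 0 0 * v ^ 2) * gradSq ((p : E3) 2) =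
      g.det * radiusSq ((p : E3) 2) := by
    rw [hpart]
    field_simp
    rw [hg]
    ring
  field_simp
  linear_combination (-(2 + R2) : ℝ) * hpart' - 4 * gradSq ((p : E3) 2) * hdet2 + 4 * g.det * hg

/-! ### The enclosed domain and the outward normal -/

/-- A defining function of the surface, negative inside and positive outside. -/
def levelFun (x : E3) : ℝ := x 0 ^ 2 + x 1 ^ 2 - radiusSq (x 2)

theorem continuous_levelFun : Continuous levelFun := by
  have := contDiff_radiusSq.continuous
  unfold levelFun
  fun_prop

/-- Beyond height 1 the formula for `bendSq` turns negative, so the zero set of `levelFun` on all of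
`ℝ³` has no further sheets. -/
theorem abs_le_one_of_radiusSq_nonneg {s : ℝ} (h : 0 ≤ radiusSq s) : |s| ≤ 1 := by
  by_contra h1
  have h2 : 1 < s ^ 2 := (one_lt_sq_iff_one_lt_abs s).2 (not_le.1 h1)
  have h3 := one_lt_bend h2
  have h4 : bendSq s < 0 := by rw [bendSq]; linarith
  have := mul_neg_of_pos_of_neg (pow_pos (Real.cosh_pos s) 2) h4
  rw [radiusSq] at h
  linarith

theorem range_bentSurface : range bentSurface = {x | levelFun x = 0} := by
  ext x
  constructor
  · rintro ⟨p, rfl⟩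
    simp only [mem_ofPred_eq, levelFun, bentSurface, surfaceExt, Matrix.cons_val_zero,
      Matrix.cons_val_one, Matrix.cons_val]
    rw [← stretch_sq]
    linear_combination stretch ((p : E3) 2) ^ 2 * sphere_sum_sq p
  · intro hx
    have hk := stretch_pos (x 2)
    have h1 : x 0 ^ 2 + x 1 ^ 2 = stretch (x 2) ^ 2 * (1 - x 2 ^ 2) := by
      rw [stretch_sq]
      have : x 0 ^ 2 + x 1 ^ 2 - radiusSq (x 2) = 0 := hx
      linarith
    have h2 : ‖(!₂[x 0 / stretch (x 2), x 1 / stretch (x 2), x 2] : E3)‖ = 1 := by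
      rw [EuclideanSpace.norm_eq, Fin.sum_univ_three, Real.sqrt_eq_one]
      simp only [Real.norm_eq_abs, sq_abs, Matrix.cons_val_zero, Matrix.cons_val_one,
        Matrix.cons_val]
      field_simp
      linarith
    refine ⟨⟨_, by simpa using h2⟩, ?_⟩
    ext i
    fin_cases i
    · simp [bentSurface, surfaceExt]
      field_simp
    · simp [bentSurface, surfaceExt]
      field_simp
    · simp [bentSurface, surfaceExt]

/-- The negative set is bounded and a component of the complement cannot leave it. A point of the
positive set escapes to infinity along a horizontal ray on which `levelFun` stays positive. -/
theorem enclosedDomain_bentSurface : enclosedDomain (range bentSurface) = {x | levelFun x < 0} := by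
  rw [range_bentSurface]
  ext x
  simp only [enclosedDomain, mem_ofPred_eq, mem_compl_iff]
  have hbounded : Bornology.IsBounded {y : E3 | levelFun y < 0} := by
    refine (Metric.isBounded_closedBall (x := (0 : E3)) (r := Real.cosh 1 + 1)).subset ?_
    intro y hy
    have hy' : y 0 ^ 2 + y 1 ^ 2 < radiusSq (y 2) := sub_neg.1 hy
    have h1 := abs_le_one_of_radiusSq_nonneg
      ((add_nonneg (sq_nonneg _) (sq_nonneg _)).trans hy'.le)
    have h2 : y 2 ^ 2 ≤ 1 := (sq_le_one_iff_abs_le_one _).2 h1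
    have h3 : radiusSq (y 2) ≤ Real.cosh 1 ^ 2 := by
      have h4 : Real.cosh (y 2) ≤ Real.cosh 1 := Real.cosh_le_cosh.2 (by simpa using h1)
      have h5 : bendSq (y 2) ≤ 1 := by rw [bendSq]; linarith [bend_nonneg (y 2 ^ 2)]
      have h6 : Real.cosh (y 2) ^ 2 ≤ Real.cosh 1 ^ 2 := pow_le_pow_left₀ (Real.cosh_pos _).le h4 2
      have h7 := bendSq_nonneg h1
      rw [radiusSq]
      nlinarith [sq_nonneg (Real.cosh (y 2))]
    rw [mem_closedBall_zero_iff, EuclideanSpace.norm_eq, Fin.sum_univ_three]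
    simp only [Real.norm_eq_abs, sq_abs]
    have h8 := Real.cosh_pos 1
    apply Real.sqrt_le_iff.2
    constructor
    · linarith
    · nlinarith
  constructor
  · rintro ⟨hx, hb⟩
    by_contra hneg
    have hpos : 0 < levelFun x := lt_of_le_of_ne (not_lt.1 hneg) (Ne.symm hx)
    -- The ray runs along `±e₁`, with the sign for which `x₁²` does not decrease.
    set d : ℝ := if 0 ≤ x 0 then 1 else -1 with hd
    have hd0 : 0 ≤ d * x 0 := by
      rw [hd]; split_ifs with h <;> linarith
    have hd1 : d ^ 2 = 1 := by
      rw [hd]; split_ifs <;> norm_num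
    set γ : ℝ → E3 := fun l => x + (l * d) • EuclideanSpace.single 0 1 with hγ
    have hγc : Continuous γ := by fun_prop
    have hray : γ '' Ici 0 ⊆ {y | levelFun y = 0}ᶜ := by
      rintro _ ⟨l, hl, rfl⟩
      have h1 : levelFun (γ l) = levelFun x + 2 * l * (d * x 0) + l ^ 2 * d ^ 2 := by
        simp [levelFun, hγ]
        ring
      have hl' : (0 : ℝ) ≤ l := hl
      have h2 : 0 < levelFun (γ l) := by
        rw [h1]; positivity
      exact h2.ne'
    have hsub : γ '' Ici 0 ⊆ connectedComponentIn {y | levelFun y = 0}ᶜ x :=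
      (isPreconnected_Ici.image γ hγc.continuousOn).subset_connectedComponentIn
        ⟨0, by simp, by simp [hγ]⟩ hray
    obtain ⟨C, hC⟩ := isBounded_iff_forall_norm_le.1 (hb.subset hsub)
    have h1 := hC (γ (C + ‖x‖ + 1)) ⟨_, by
      have := hC x ⟨0, by simp, by simp [hγ]⟩
      have := norm_nonneg x
      exact mem_Ici.2 (by linarith), rfl⟩
    have h2 : ‖((C + ‖x‖ + 1) * d) • (EuclideanSpace.single 0 1 : E3)‖ = |C + ‖x‖ + 1| := by
      have h3 : |d| = 1 := by
        rw [← sq_eq_sq₀ (abs_nonneg d) zero_le_one, sq_abs, hd1, one_pow]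
      rw [norm_smul, Real.norm_eq_abs, abs_mul, h3]
      simp
    have h3 : ‖((C + ‖x‖ + 1) * d) • (EuclideanSpace.single 0 1 : E3)‖ ≤ C + ‖x‖ := by
      have : ((C + ‖x‖ + 1) * d) • (EuclideanSpace.single 0 1 : E3) = γ (C + ‖x‖ + 1) - x := by
        simp [hγ]
      rw [this]
      exact (norm_sub_le _ _).trans (by linarith)
    rw [h2] at h3
    linarith [le_abs_self (C + ‖x‖ + 1)]
  · intro hx
    refine ⟨hx.ne, hbounded.subset ?_⟩
    have hopen : IsOpen {y : E3 | levelFun y < 0} := isOpen_lt continuous_levelFun continuous_const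
    have hopen' : IsOpen {y : E3 | 0 < levelFun y} := isOpen_lt continuous_const continuous_levelFun
    have hpre : IsPreconnected (connectedComponentIn {y | levelFun y = 0}ᶜ x) :=
      isPreconnected_connectedComponentIn
    have hmem : x ∈ connectedComponentIn {y | levelFun y = 0}ᶜ x :=
      mem_connectedComponentIn hx.ne
    refine hpre.subset_left_of_subset_union hopen hopen' ?_ ?_ ⟨x, hmem, hx⟩
    · exact disjoint_left.2 fun y (h1 : levelFun y < 0) h2 => lt_asymm h1 h2
    · intro y hy
      exact lt_or_gt_of_ne (connectedComponentIn_subset _ _ hy)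

/-- The gradient of `levelFun` on the surface is `2 normalExt`, so its derivative along the unit
normal is `2 √gradSq > 0`. -/
theorem isOutwardUnitNormal_bentNormal : IsOutwardUnitNormal bentSurface bentNormal := by
  refine ⟨isUnitNormal_bentNormal, fun p => ?_⟩
  rw [enclosedDomain_bentSurface, range_bentSurface]
  have hD := Real.sqrt_pos.2 (gradSq_pos (abs_sphere_le p))
  have h0 : levelFun (bentSurface p) = 0 := by
    have : bentSurface p ∈ range bentSurface := ⟨p, rfl⟩
    rwa [range_bentSurface] at this
  have hcoord : ∀ i : Fin 3, HasDerivAt (fun s : ℝ => (bentSurface p + s • bentNormal p) i)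
      (bentNormal p i) 0 := fun i => by
    have := ((hasDerivAt_id (0 : ℝ)).mul_const (bentNormal p i)).const_add (bentSurface p i)
    simpa using this
  have hder : HasDerivAt (fun s : ℝ => levelFun (bentSurface p + s • bentNormal p))
      (2 * √(gradSq ((p : E3) 2))) 0 := by
    have h1 := (((hcoord 0).pow 2).add ((hcoord 1).pow 2)).sub
      (HasDerivAt.comp (h₂ := radiusSq) (0 : ℝ) (hasDerivAt_radiusSq _) (hcoord 2))
    refine HasDerivAt.congr_deriv h1 ?_
    have h2 := inner_normalExt_self p
    rw [inner_three] at h2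
    have h3 := Real.mul_self_sqrt (gradSq_pos (abs_sphere_le p)).le
    simp only [zero_smul, add_zero, bentNormal, unitNormalExt, PiLp.smul_apply, smul_eq_mul]
    simp only [normalExt, bentSurface, surfaceExt, Matrix.cons_val_zero, Matrix.cons_val_one,
      Matrix.cons_val] at h2 ⊢
    field_simp
    norm_num
    linear_combination 4 * h2 - 4 * h3
  rw [hasDerivAt_iff_tendsto_slope] at hder
  have hev := hder.eventually_const_lt (show 0 < 2 * √(gradSq ((p : E3) 2)) by positivity)
  have hpos : ∀ᶠ s in 𝓝[>] (0 : ℝ), 0 < levelFun (bentSurface p + s • bentNormal p) := by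
    filter_upwards [hev.filter_mono (nhdsWithin_mono _ fun s (hs : 0 < s) => hs.ne'),
      self_mem_nhdsWithin] with s hs hs0
    rw [slope_def_field] at hs
    simp only [zero_smul, add_zero, h0, sub_zero] at hs
    exact (div_pos_iff_of_pos_right hs0).1 hs
  have hneg : ∀ᶠ s in 𝓝[>] (0 : ℝ), levelFun (bentSurface p - s • bentNormal p) < 0 := by
    have ht : Tendsto (fun s : ℝ => -s) (𝓝[>] 0) (𝓝[≠] 0) := by
      refine tendsto_nhdsWithin_of_tendsto_nhds_of_eventually_within _ ?_ ?_
      · have : Tendsto (fun s : ℝ => -s) (𝓝 0) (𝓝 (-0)) := tendsto_id.neg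
        rw [neg_zero] at this
        exact this.mono_left nhdsWithin_le_nhds
      · filter_upwards [self_mem_nhdsWithin] with s hs
        exact neg_ne_zero.2 (ne_of_gt hs)
    filter_upwards [ht.eventually hev, self_mem_nhdsWithin] with s hs hs0
    rw [slope_def_field] at hs
    simp only [zero_smul, add_zero, h0, sub_zero, neg_smul, ← sub_eq_add_neg] at hs
    rcases div_pos_iff.1 hs with h1 | h1
    · have : (0 : ℝ) < s := hs0
      linarith [h1.2]
    · exact h1.1
  filter_upwards [hpos, hneg] with s h1 h2
  exact ⟨h2, fun h3 => h3.elim (fun h4 => h1.ne' h4) (fun h4 => lt_asymm h1 h4)⟩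

/-- Two unit normals agree up to sign at each point, and the opposite sign would put `f p + s N p`
both inside and outside. It identifies the normal `N 0` carried by an arbitrary solution. -/
theorem IsOutwardUnitNormal.unique {f N N' : S2 → E3} (hf : IsSmoothImmersion f)
    (h : IsOutwardUnitNormal f N) (h' : IsOutwardUnitNormal f N') : N' = N := by
  ext1 p
  obtain ⟨hN, hNv⟩ := h.1.2 p
  obtain ⟨hN', hNv'⟩ := h'.1.2 p
  have hn0 : N p ≠ 0 := by intro h0; simp [h0] at hN
  obtain ⟨r, s, t, hrst⟩ := exists_decomposition (tangent_independent (hf.2 p)) hn0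
    (hNv _) (hNv _) (N' p)
  have h1 : N' p - t • N p =
      r • diff f p (tangentBasis 0) + s • diff f p (tangentBasis 1) := by
    rw [hrst]; abel
  have h2 : inner ℝ (N' p - t • N p) (N' p - t • N p) = 0 := by
    conv_lhs => rw [h1]
    rw [← h1, inner_sub_left, real_inner_smul_left, h1]
    simp only [inner_add_right, real_inner_smul_right, hNv, hNv']
    ring
  have h3 : N' p = t • N p := sub_eq_zero.1 (inner_self_eq_zero.1 h2)
  have h4 : |t| = 1 := by
    have := congrArg norm h3
    rw [norm_smul, hN, hN', mul_one, Real.norm_eq_abs] at this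
    exact this.symm
  rcases (abs_eq zero_le_one).1 h4 with h5 | h5
  · rw [h3, h5, one_smul]
  · exfalso
    obtain ⟨s, hs, hs'⟩ := ((h.2 p).and (h'.2 p)).exists
    refine hs.2 (Or.inr ?_)
    have := hs'.1
    rw [h3, h5] at this
    simpa using this

/-! ### The catenoidal neck and the caps -/

theorem bentCatenary_eq (z : ℝ) : bentCatenary bendFactor (1 / 2) z = Real.cosh z * √(bendSq z) := by
  rw [bentCatenary]
  split_ifs with h
  · rw [bendSq_of_le h, Real.sqrt_one, mul_one]
  · rw [bendFactor, bendSq, bendSq, sq_abs]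

theorem bentCatenary_sq {z : ℝ} (h : |z| ≤ 1) :
    bentCatenary bendFactor (1 / 2) z ^ 2 = radiusSq z := by
  rw [bentCatenary_eq, mul_pow, Real.sq_sqrt (bendSq_nonneg h), radiusSq]

theorem range_bentSurface_eq_revolution :
    range bentSurface = revolution (bentCatenary bendFactor (1 / 2)) 1 := by
  rw [range_bentSurface]
  ext x
  constructor
  · intro hx
    have hx' : x 0 ^ 2 + x 1 ^ 2 = radiusSq (x 2) := sub_eq_zero.1 hx
    have h1 : |x 2| ≤ 1 := abs_le_one_of_radiusSq_nonneg (by rw [← hx']; positivity)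
    have h2 : ‖(⟨x 0, x 1⟩ : ℂ)‖ = bentCatenary bendFactor (1 / 2) (x 2) := by
      have h3 : 0 ≤ bentCatenary bendFactor (1 / 2) (x 2) := by
        rw [bentCatenary_eq]; exact mul_nonneg (Real.cosh_pos _).le (Real.sqrt_nonneg _)
      rw [← sq_eq_sq₀ (norm_nonneg _) h3, bentCatenary_sq h1, ← hx', Complex.sq_norm,
        Complex.normSq_mk]
      ring
    refine ⟨x 2, abs_le.1 h1, Complex.arg ⟨x 0, x 1⟩, ?_⟩
    rw [← h2, Complex.norm_mul_cos_arg, Complex.norm_mul_sin_arg]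
    ext i
    fin_cases i <;> rfl
  · rintro ⟨z, hz, θ, rfl⟩
    simp only [mem_ofPred_eq, levelFun, Matrix.cons_val_zero, Matrix.cons_val_one, Matrix.cons_val]
    rw [← bentCatenary_sq (abs_le.2 hz)]
    linear_combination (bentCatenary bendFactor (1 / 2) z) ^ 2 * Real.sin_sq_add_cos_sq θ

theorem meanCurvature_bentSurface_eq_zero {p : S2} (h : |(p : E3) 2| ≤ 1 / 2) :
    meanCurvature bentSurface bentNormal p = 0 := by
  rw [meanCurvature_bentSurface, curvatureNum_of_le h, zero_div]

theorem meanCurvature_bentSurface_pos {p : S2} (h : 1 / 2 < |(p : E3) 2|) :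
    0 < meanCurvature bentSurface bentNormal p := by
  have hD := gradSq_pos (abs_sphere_le p)
  rw [meanCurvature_bentSurface]
  exact div_pos (curvatureNum_pos h (abs_sphere_le p)) (mul_pos hD (Real.sqrt_pos.2 hD))

/-- The open catenoidal neck. -/
def neck : Set S2 := {p | |bentSurface p 2| < 1 / 2}

theorem mem_neck {p : S2} : p ∈ neck ↔ |(p : E3) 2| < 1 / 2 := Iff.rfl

theorem isOpen_neck : IsOpen neck := by
  have : Continuous fun p : S2 => |(p : E3) 2| := by fun_prop
  exact isOpen_lt this continuous_const

theorem mem_closure_neck {p : S2} : p ∈ closure neck ↔ |(p : E3) 2| ≤ 1 / 2 := by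
  have hcont : Continuous fun p : S2 => |(p : E3) 2| := by fun_prop
  constructor
  · intro hp
    exact closure_minimal (fun q hq => (mem_neck.1 hq).le) (isClosed_le hcont continuous_const) hp
  · intro hp
    have hp2 : (p : E3) 2 ^ 2 ≤ 1 / 4 := sq_le_quarter.2 hp
    have hsum := sphere_sum_sq p
    -- A point of the boundary circle is approached from the neck by shrinking its third coordinate
    -- by `1 - l` and projecting back to the sphere.
    set γ : ℝ → E3 := fun l => (p : E3) - (l * (p : E3) 2) • EuclideanSpace.single 2 1 with hγ
    have hγc : Continuous γ := by fun_prop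
    have hγ0 : γ 0 = p := by simp [hγ]
    have hr : ContinuousAt retract (γ 0) := by
      rw [hγ0]
      exact (contMDiffOn_retract.contMDiffAt
        (isOpen_compl_singleton.mem_nhds (coe_sphere_ne_zero p))).continuousAt
    have ht : Tendsto (fun l => retract (γ l)) (𝓝[>] 0) (𝓝 p) := by
      have := (ContinuousAt.comp (f := γ) hr hγc.continuousAt).tendsto
      rw [Function.comp_apply, hγ0, retract_coe] at this
      exact this.mono_left nhdsWithin_le_nhds
    refine mem_closure_of_tendsto ht ?_
    filter_upwards [Ioo_mem_nhdsGT (zero_lt_one (α := ℝ))] with l hl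
    have hl1 : 0 < 1 - l := by linarith [hl.2]
    have h0 : γ l 0 = (p : E3) 0 := by simp [hγ]
    have h1 : γ l 1 = (p : E3) 1 := by simp [hγ]
    have h2 : γ l 2 = (1 - l) * (p : E3) 2 := by simp [hγ]; ring
    have hnorm : ‖γ l‖ ^ 2 = 1 - (p : E3) 2 ^ 2 + (1 - l) ^ 2 * (p : E3) 2 ^ 2 := by
      rw [EuclideanSpace.norm_sq_eq, Fin.sum_univ_three]
      simp only [Real.norm_eq_abs, sq_abs, h0, h1, h2]
      linear_combination hsum
    have hne : γ l ≠ 0 := by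
      intro hz
      rw [hz, norm_zero] at hnorm
      nlinarith [mul_nonneg (sq_nonneg (1 - l)) (sq_nonneg ((p : E3) 2))]
    have hnpos : 0 < ‖γ l‖ := norm_pos_iff.2 hne
    rw [mem_neck, coe_retract hne, PiLp.smul_apply, smul_eq_mul, h2]
    rw [abs_mul, abs_inv, abs_norm, inv_mul_lt_iff₀ hnpos]
    refine abs_lt_of_sq_lt_sq ?_ (by positivity)
    have hm : (1 - l) ^ 2 < 1 := by nlinarith [hl.1]
    have hm' : (1 - l) ^ 2 * (p : E3) 2 ^ 2 ≤ (1 - l) ^ 2 * (1 / 4) :=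
      mul_le_mul_of_nonneg_left hp2 (sq_nonneg _)
    rw [mul_pow, mul_pow, hnorm]
    linarith

/-- The point `e₁` of the sphere. -/
def equatorPoint : S2 := ⟨EuclideanSpace.single 0 1, by simp⟩

theorem equatorPoint_mem_neck : equatorPoint ∈ neck := by
  rw [mem_neck]; simp [equatorPoint]

theorem frame_equatorPoint (i : Fin 2) : frame equatorPoint i 0 = 0 := by
  have := inner_coe_frame equatorPoint i
  rw [inner_three] at this
  simpa [equatorPoint] using this

theorem diff_bentSurface_equatorPoint (i : Fin 2) :
    diff bentSurface equatorPoint (tangentBasis i) =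
      !₂[0, frame equatorPoint i 1, frame equatorPoint i 2] := by
  have h0 := frame_equatorPoint i
  rw [diff_bentSurface, fderiv_surfaceExt]
  change !₂[_ * frame equatorPoint i 0 + _ * _ * frame equatorPoint i 2,
    _ * frame equatorPoint i 1 + _ * _ * frame equatorPoint i 2, frame equatorPoint i 2] = _
  rw [h0]
  simp [equatorPoint, stretch_zero, deriv_stretch_zero]

theorem diff_bentNormal_equatorPoint (i : Fin 2) :
    diff bentNormal equatorPoint (tangentBasis i) =
      !₂[0, frame equatorPoint i 1, -frame equatorPoint i 2] := by
  have h0 := frame_equatorPoint i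
  have hq : (equatorPoint : E3) 2 = 0 := by simp [equatorPoint]
  have hz : |(0 : ℝ)| ≤ 1 / 2 := by norm_num
  have hR' : radiusSq' 0 = 0 := by simp [radiusSq', deriv_bendSq_of_le hz]
  have hD : gradSq 0 = 1 := by simp [gradSq, radiusSq, hR', bendSq_of_le hz]
  have hR'' : radiusSq'' 0 = 2 := by
    simp [radiusSq'', deriv_bendSq_of_le hz, deriv_deriv_bendSq_of_le hz, bendSq_of_le hz]
  have hm : normalExt equatorPoint = EuclideanSpace.single 0 1 := by
    ext j
    fin_cases j <;> simp [normalExt, stretch_zero, hR', equatorPoint]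
  obtain ⟨l, hl⟩ := fderiv_unitNormalExt equatorPoint
  have h1 : diff bentNormal equatorPoint (tangentBasis i) =
      !₂[0, frame equatorPoint i 1, -frame equatorPoint i 2] +
        l (frame equatorPoint i) • EuclideanSpace.single 0 1 := by
    rw [diff_bentNormal, hl, hq, hD, Real.sqrt_one, inv_one, one_smul, fderiv_normalExt, hm]
    congr 1
    change !₂[_ * frame equatorPoint i 0 + _ * _ * frame equatorPoint i 2,
      _ * frame equatorPoint i 1 + _ * _ * frame equatorPoint i 2,
      -(_ * frame equatorPoint i 2)] = _
    rw [h0, hq, hR'']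
    simp [stretch_zero, deriv_stretch_zero]
  -- The unknown coefficient `l` is the component of `dN` along `N = e₁`, which is zero.
  have h2 := inner_diff_self contMDiff_bentNormal
    (fun q => (isUnitNormal_bentNormal.2 q).1) equatorPoint (tangentBasis i)
  have h3 : bentNormal equatorPoint = EuclideanSpace.single 0 1 := by
    rw [bentNormal, unitNormalExt, hq, hD, hm]; simp
  rw [h3, h1, inner_three] at h2
  have h4 : l (frame equatorPoint i) = 0 := by simpa using h2
  rw [h1, h4, zero_smul, add_zero]

/-- The north pole of the sphere. -/
def northPole : S2 := ⟨EuclideanSpace.single 2 1, by simp⟩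

theorem meanCurvature_bentSurface_nonneg (p : S2) :
    0 ≤ meanCurvature bentSurface bentNormal p := by
  rcases le_or_gt |(p : E3) 2| (1 / 2) with h | h
  · exact (meanCurvature_bentSurface_eq_zero h).ge
  · exact (meanCurvature_bentSurface_pos h).le

theorem exists_iInf_meanCurvature_neg_bentSurface {η : (S2 → E3) → (S2 → E3) → ℝ} {T : ℝ}
    {F N : ℝ → S2 → E3} (h : IsConstrainedMCF η bentSurface T F N) (hT : 0 < T) {c : ℝ}
    (hc0 : 0 < c) (hc : Tendsto (fun t => η (F t) (N t)) (𝓝[Ico 0 T] 0) (𝓝 c)) :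
    ∃ ε : ℝ, 0 < ε ∧ ε ≤ T ∧ ∀ t ∈ Ioo 0 ε, (⨅ q : S2, meanCurvature (F t) (N t) q) < (0 : ℝ) := by
  have hN0 : N 0 = bentNormal :=
    isOutwardUnitNormal_bentNormal.unique isSmoothImmersion_bentSurface h.outward
  refine h.exists_iInf_meanCurvature_neg hT hc0 hc isOpen_neck ?_ equatorPoint_mem_neck
    (x := fun i => frame equatorPoint i 1) (y := fun i => frame equatorPoint i 2) ?_ ?_
  · intro q hq
    rw [h.initial, hN0]
    exact meanCurvature_bentSurface_eq_zero (mem_neck.1 hq).le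
  · rw [h.initial]; exact diff_bentSurface_equatorPoint
  · rw [hN0]; exact diff_bentNormal_equatorPoint

theorem exists_tendsto_globalTerm_bentSurface {η : (S2 → E3) → (S2 → E3) → ℝ} {T : ℝ}
    {F N : ℝ → S2 → E3} (h : IsConstrainedMCF η bentSurface T F N) (hT : 0 < T) :
    (∃ c, 0 < c ∧ Tendsto (fun t => vpTerm (F t) (N t)) (𝓝[Ico 0 T] 0) (𝓝 c)) ∧
      ∃ c, 0 < c ∧ Tendsto (fun t => apTerm (F t) (N t)) (𝓝[Ico 0 T] 0) (𝓝 c) := by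
  have hN0 : N 0 = bentNormal :=
    isOutwardUnitNormal_bentNormal.unique isSmoothImmersion_bentSurface h.outward
  refine exists_tendsto_globalTerm (uniqueDiffOn_Ico 0 T) h.smooth h.smooth_normal
    isLocallyClosed_Ico h.immersion (fun t ht => (h.normal t ht).1) ⟨le_rfl, hT⟩ ?_
    (p := northPole) ?_
  · rw [h.initial, hN0]; exact meanCurvature_bentSurface_nonneg
  · rw [h.initial, hN0]
    apply meanCurvature_bentSurface_pos
    simp [northPole]
    norm_num

end ConstrainedMCF

end
-- Conclusion for both flows
open ConstrainedMCF in
theorem mainTheorem1 :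
    ∃ (F₀ N₀ : S2 → E3) (U : Set S2) (a b : ℝ) (φ : ℝ → ℝ),
      -- a smoothly embedded sphere with its outward unit normal
      IsSmoothEmbedding F₀ ∧ IsOutwardUnitNormal F₀ N₀ ∧
      -- it is a surface of revolution: a catenoidal neck with two caps
      0 < a ∧ a < b ∧
      StrictAntiOn φ (Set.Icc a b) ∧ ConcaveOn ℝ (Set.Icc a b) φ ∧ φ a = 1 ∧ φ b = 0 ∧
      Set.range F₀ = revolution (bentCatenary φ a) b ∧
      -- `U` is the open neck; `H` vanishes on its closure and is positive elsewhere
      IsOpen U ∧ U.Nonempty ∧ U = {p | |F₀ p 2| < a} ∧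
      (∀ p ∈ closure U, meanCurvature F₀ N₀ p = 0) ∧
      (∀ p ∉ closure U, 0 < meanCurvature F₀ N₀ p) ∧
      -- loss of non-strict mean convexity under both flows
      ∀ (T : ℝ) (F N : ℝ → S2 → E3), 0 < T → (IsVPMCF F₀ T F N ∨ IsAPMCF F₀ T F N) →
        ∃ ε : ℝ, 0 < ε ∧ ε ≤ T ∧
          ∀ t ∈ Set.Ioo 0 ε, (⨅ p : S2, meanCurvature (F t) (N t) p) < (0 : ℝ) := by
  refine ⟨bentSurface, bentNormal, neck, 1 / 2, 1, bendFactor, isSmoothEmbedding_bentSurface,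
    isOutwardUnitNormal_bentNormal, by norm_num, by norm_num, strictAntiOn_bendFactor,
    concaveOn_bendFactor, ?_, ?_, range_bentSurface_eq_revolution, isOpen_neck,
    ⟨_, equatorPoint_mem_neck⟩, rfl, fun p hp => ?_, fun p hp => ?_, fun T F N hT hflow => ?_⟩
  · rw [bendFactor, bendSq_of_le (by norm_num [abs_of_pos]), Real.sqrt_one]
  · rw [bendFactor, bendSq_one, Real.sqrt_zero]
  · exact meanCurvature_bentSurface_eq_zero (mem_closure_neck.1 hp)
  · exact meanCurvature_bentSurface_pos (not_le.1 fun h => hp (mem_closure_neck.2 h))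
  -- The two flows enter only through the fact that the global term tends to a positive limit as `t
  -- → 0`.
  · rcases hflow with h | h
    · obtain ⟨⟨c, hc0, hc⟩, -⟩ := exists_tendsto_globalTerm_bentSurface h hT
      exact exists_iInf_meanCurvature_neg_bentSurface h hT hc0 hc
    · obtain ⟨-, c, hc0, hc⟩ := exists_tendsto_globalTerm_bentSurface h.1 hT
      exact exists_iInf_meanCurvature_neg_bentSurface h.1 hT hc0 hc
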